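/- Let $n\ge 2$ and $t\ge 2$. Let $X\subset\mathbb R^n$ be a finite set with a weight function $w:X\to\mathbb R_{>0}$, and suppose that exactly two numbers $r_1\neq r_2$ occur as norms $\|x\|$ of points $x\in X$ (one of them may be $0$). Put $S_i=\{x\in\mathbb R^n:\|x\|=r_i\}$, $X_i=X\cap S_i$, $w(X_i)=\sum_{x\in X_i}w(x)$ and $S=S_1\cup S_2$; we say that $X$ is supported by the two concentric spheres $S_1,S_2$. Let $\mathrm{Hom}_l(\mathbb R^n)$ be the space of real homogeneous polynomials of degree $l$ in $n$ variables, $\mathcal P_e(\mathbb R^n)=\bigoplus_{i=0}^{e}\mathrm{Hom}_i(\mathbb R^n)$, $\mathcal P^*_e(\mathbb R^n)=\bigoplus_{i=0}^{\lfloor e/2\rfloor}\mathrm{Hom}_{e-2i}(\mathbb R^n)$, and let $\mathcal P_e(S)$, $\mathcal P_e^*(S)$ be the spaces of restrictions to $S$ of these polynomials. Suppose that $(X,w)$ is a Euclidean $t$-design, that is, $$\sum_{i=1}^{2}\frac{w(X_i)}{|S_i|}\int_{S_i}f\,d\sigma_i=\sum_{u\in X}w(u)f(u)\qquad\text{for all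 } f\in\mathcal P_t(\mathbb R^n),$$ where $\sigma_i$ is the surface measure on $S_i$, $|S_i|=\sigma_i(S_i)$, and the normalized integral over $S_i$ means $f(0)$ if $r_i=0$. Suppose moreover that $(X,w)$ is tight, that is, equality holds in Möller's lower bound: - if $t=2e$, then $|X|=\dim\mathcal P_e(S)$; - if $t=2e+1$, then $|X|=2\dim\mathcal P^*_e(S)-1$ when $e$ is even and $0\in X$, and $|X|=2\dim\mathcal P^*_e(S)$ otherwise. Then $X$ has the structure of a coherent configuration. Precisely, let $\mathcal R$ be the set of all nonempty relations $$R_{\lambda,\mu}^{(\alpha)}=\{(x,y)\in X_\lambda\times X_\mu:\ x\cdot y=\alpha\, r_\lambda r_\mu\},\qquad \lambda,\mu\in\{1,2\},\ \alpha\in\mathbb R.$$ Then $\mathcal R$ is a coherent configuration on $X$: it is a partition of $X\times X$; every relation in $\mathcal R$ that meets the diagonal $\{(x,x):x\in X\}$ is contained in it; the transpose of each relation in $\mathcal R$ belongs to $\mathcal R$; and for all $R,R',R''\in\mathcal R$ the number of $z\in X$ with $(x,z)\in R$ and $(z,y)\in R'$ is the same for all $(x,y)\in R''$. -/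

import Mathlib

open MeasureTheory Metric

noncomputable section

namespace EuclideanDesign

/-- Coherent configuration (Higman) on a finite set `V`: a partition `𝓡` of `V × V` into nonempty
relations such that the diagonal is a union of relations, `𝓡` is closed under transposition, and
the intersection numbers are well defined. -/
structure IsCoherentConfiguration {V : Type*} [Finite V] (𝓡 : Set (Set (V × V))) : Prop where
  partition : Setoid.IsPartition 𝓡
  diagonal : ∀ R ∈ 𝓡, (∃ x, (x, x) ∈ R) → ∀ x y, (x, y) ∈ R → x = y
  transpose : ∀ R ∈ 𝓡, {p : V × V | (p.2, p.1) ∈ R} ∈ 𝓡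
  intersection : ∀ R ∈ 𝓡, ∀ S ∈ 𝓡, ∀ T ∈ 𝓡, ∃ c : ℕ, ∀ x y, (x, y) ∈ T →
    {z : V | (x, z) ∈ R ∧ (z, y) ∈ S}.ncard = c

variable {n : ℕ}

/-- The distinct radii `r₁, …, r_p` of the spheres centred at the origin that meet `X`
(a radius may be `0`). -/
def radii (X : Finset (EuclideanSpace ℝ (Fin n))) : Finset ℝ :=
  X.image fun x => ‖x‖

/-- The layer `X_i = X ∩ S^{n-1}(r_i)`. -/
def layer (X : Finset (EuclideanSpace ℝ (Fin n))) (r : ℝ) :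
    Finset (EuclideanSpace ℝ (Fin n)) :=
  X.filter fun x => ‖x‖ = r

/-- `S`, the union of the spheres centred at the origin that support `X`. -/
def supportingSpheres (X : Finset (EuclideanSpace ℝ (Fin n))) :
    Set (EuclideanSpace ℝ (Fin n)) :=
  {x | ‖x‖ ∈ radii X}

/-- The value of a polynomial in `n` variables at a point of `ℝⁿ`. -/
def polyEval (f : MvPolynomial (Fin n) ℝ) (x : EuclideanSpace ℝ (Fin n)) : ℝ :=
  MvPolynomial.eval (fun i => x i) f

/-- The normalized integral of `f` over the sphere of radius `r` centred at the origin: the average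
of `u ↦ f (r u)` over the unit sphere with its surface measure. For `r = 0` this is `f 0`, see
`sphereAverage_zero`. -/
def sphereAverage (r : ℝ) (f : EuclideanSpace ℝ (Fin n) → ℝ) : ℝ :=
  ⨍ u : sphere (0 : EuclideanSpace ℝ (Fin n)) 1,
    f (r • (u : EuclideanSpace ℝ (Fin n)))
      ∂(volume : Measure (EuclideanSpace ℝ (Fin n))).toSphere

theorem sphereAverage_zero (hn : 0 < n) (f : EuclideanSpace ℝ (Fin n) → ℝ) :
    sphereAverage 0 f = f 0 := by
  have : Nonempty (Fin n) := ⟨⟨0, hn⟩⟩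
  have : Nontrivial (EuclideanSpace ℝ (Fin n)) := inferInstance
  have : NeZero (volume : Measure (EuclideanSpace ℝ (Fin n))).toSphere := by
    refine ⟨fun h => ?_⟩
    rw [Measure.toSphere_eq_zero_iff_finrank] at h
    simp at h
    omega
  unfold sphereAverage
  simp only [zero_smul]
  exact average_const _ _

/-- `(X, w)` is a Euclidean `t`-design. -/
def IsEuclideanDesign (t : ℕ) (X : Finset (EuclideanSpace ℝ (Fin n)))
    (w : EuclideanSpace ℝ (Fin n) → ℝ) : Prop :=
  ∀ f : MvPolynomial (Fin n) ℝ, f.totalDegree ≤ t →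
    ∑ r ∈ radii X, (∑ x ∈ layer X r, w x) * sphereAverage r (polyEval f) =
      ∑ u ∈ X, w u * polyEval f u

/-- Restriction of polynomials to a subset of `ℝⁿ`. -/
def restrictTo (S : Set (EuclideanSpace ℝ (Fin n))) :
    MvPolynomial (Fin n) ℝ →ₗ[ℝ] (S → ℝ) where
  toFun f x := polyEval f x
  map_add' f g := by ext x; simp [polyEval]
  map_smul' c f := by ext x; simp [polyEval]

/-- `𝒫_e(S)`: the restrictions to `S` of polynomials of degree at most `e`. -/
def polyOn (S : Set (EuclideanSpace ℝ (Fin n))) (e : ℕ) : Submodule ℝ (S → ℝ) :=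
  (MvPolynomial.restrictTotalDegree (Fin n) ℝ e).map (restrictTo S)

/-- `𝒫*_e(S)`: the restrictions to `S` of the polynomials in `⨁_{0 ≤ i ≤ e/2} Hom_{e-2i}(ℝⁿ)`. -/
def parityPolyOn (S : Set (EuclideanSpace ℝ (Fin n))) (e : ℕ) : Submodule ℝ (S → ℝ) :=
  (⨆ i ∈ Finset.range (e / 2 + 1),
    MvPolynomial.homogeneousSubmodule (Fin n) ℝ (e - 2 * i)).map (restrictTo S)

open Classical in
/-- Möller's lower bound for the size of a Euclidean `t`-design with the supporting spheres `S`
of `X`: `dim 𝒫_e(S)` if `t = 2e`; if `t = 2e + 1`, then `2 dim 𝒫*_e(S) - 1` when `e` is even and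
`0 ∈ X` (then `dim 𝒫*_e(S) ≥ 1`), and `2 dim 𝒫*_e(S)` otherwise. -/
def moellerBound (t : ℕ) (X : Finset (EuclideanSpace ℝ (Fin n))) : ℕ :=
  if Even t then
    Module.finrank ℝ (polyOn (supportingSpheres X) (t / 2))
  else if Even (t / 2) ∧ (0 : EuclideanSpace ℝ (Fin n)) ∈ X then
    2 * Module.finrank ℝ (parityPolyOn (supportingSpheres X) (t / 2)) - 1
  else
    2 * Module.finrank ℝ (parityPolyOn (supportingSpheres X) (t / 2))

/-- A tight Euclidean `t`-design (on its supporting spheres). -/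
def IsTightEuclideanDesign (t : ℕ) (X : Finset (EuclideanSpace ℝ (Fin n)))
    (w : EuclideanSpace ℝ (Fin n) → ℝ) : Prop :=
  IsEuclideanDesign t X w ∧ X.card = moellerBound t X

/-- The pairs `(x, y)` of points of `X` with `‖x‖ = r`, `‖y‖ = s` and normalized inner product
`x · y / (r s) = a`. (If `r = 0` or `s = 0` there is no condition on the inner product.) -/
def innerRelation (X : Finset (EuclideanSpace ℝ (Fin n))) (r s a : ℝ) : Set (X × X) :=
  {p | ‖(p.1 : EuclideanSpace ℝ (Fin n))‖ = r ∧ ‖(p.2 : EuclideanSpace ℝ (Fin n))‖ = s ∧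
    inner ℝ (p.1 : EuclideanSpace ℝ (Fin n)) (p.2 : EuclideanSpace ℝ (Fin n)) = a * (r * s)}

/-- The nonempty relations determined by the layers of the two points and their normalized inner
product. For `r = s > 0` and `a = 1` the relation is the diagonal of that layer. -/
def innerRelations (X : Finset (EuclideanSpace ℝ (Fin n))) : Set (Set (X × X)) :=
  {R | R.Nonempty ∧ ∃ r s a : ℝ, R = innerRelation X r s a}

end EuclideanDesign

end

/-!
Let `t = 2e` or `t = 2e + 1`. The design equations enter only through the functional
`f ↦ ∑ w(u) f(u)`: on polynomial functions of degree at most `t` it is invariant under linear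
isometries, and strictly positive on nonnegative functions that are not identically zero on the two
spheres (`IsInvariantCubature`). Multiplication by `‖z‖² - s²`, where `s` is the radius of the other
sphere, gives the same for each layer in degree `t - 2`.

Tightness provides dual functions (`HasDualFunctions`). For `t = 2e`, restriction from `𝒫_e(S)` to
`X` is injective, hence bijective, and the indicator function of `x ∈ X` extends to an element of
`𝒫_e(S)`, which is the reproducing kernel at `x` up to a factor. For `t = 2e + 1`, the restrictions
to `X` of `𝒫*_e` and `𝒫*_{e+1}` are orthogonal by parity, and equality in the bound makes them
complements of each other and (up to the origin) makes `𝒫*_e|_X` invariant under multiplication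
by quotients of linear forms. Such quotients separate the lines through the origin, so the
orthogonality relations hold on each line separately, which forces `X` to be antipodal with a
symmetric weight (`IsInvariantCubature.neg_mem_and_weight_neg`). The parity `e` part of the
indicator function of `x` is then the dual function.

By uniqueness, dual functions are compatible with isometries. So the weight is constant on layers,
and the dual function at `x` is a polynomial `Φ_r` of degree at most `e` in `x · z` on the sphere of
radius `r`, whose two leading coefficients do not depend on `r` (`exists_zonal_polynomial`). It
vanishes at all `x · z` with `z ≠ x` (respectively `z ≠ ±x`) in `X`, and it is not zero
(`IsInvariantCubature.zonal_ne_zero`), so at most `e` such inner products occur between two layers.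
Hence the condition `x · z = a` on two layers is a polynomial of degree at most `e - 1` in `x · z`,
up to a correction at `z = ±x`. The number of `z` in a layer with `x · z = a` and `z · y = b` is thus
a combination of moments of degree at most `2e - 2 ≤ t - 2`, which by invariance depend only on the
norms and the inner product of `x` and `y` (`IsInvariantCubature.card_filter_inner_eq`).
-/

noncomputable section

namespace EuclideanDesign

variable {n : ℕ}

/-! ### Polynomial functions -/

/-- `polyEval` as a linear map from polynomials to functions on `ℝⁿ`. -/
def polyEvalLinear (n : ℕ) :
    MvPolynomial (Fin n) ℝ →ₗ[ℝ] (EuclideanSpace ℝ (Fin n) → ℝ) where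
  toFun := polyEval
  map_add' f g := by ext x; simp [polyEval]
  map_smul' c f := by ext x; simp [polyEval]

@[simp]
theorem polyEvalLinear_apply (p : MvPolynomial (Fin n) ℝ) : polyEvalLinear n p = polyEval p := rfl

/-- The polynomial functions of degree at most `d` on `ℝⁿ`. -/
def polyFun (n d : ℕ) : Submodule ℝ (EuclideanSpace ℝ (Fin n) → ℝ) :=
  (MvPolynomial.restrictTotalDegree (Fin n) ℝ d).map (polyEvalLinear n)

/-- The functions on `ℝⁿ` given by homogeneous polynomials of degree `d`. -/
def homFun (n d : ℕ) : Submodule ℝ (EuclideanSpace ℝ (Fin n) → ℝ) :=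
  (MvPolynomial.homogeneousSubmodule (Fin n) ℝ d).map (polyEvalLinear n)

/-- The functions on `ℝⁿ` given by polynomials in `⨁_{0 ≤ i ≤ e/2} Hom_{e-2i}(ℝⁿ)`. -/
def parityFun (n e : ℕ) : Submodule ℝ (EuclideanSpace ℝ (Fin n) → ℝ) :=
  ⨆ i ∈ Finset.range (e / 2 + 1), homFun n (e - 2 * i)

theorem mem_polyFun {d : ℕ} {f : EuclideanSpace ℝ (Fin n) → ℝ} :
    f ∈ polyFun n d ↔ ∃ p : MvPolynomial (Fin n) ℝ, p.totalDegree ≤ d ∧ polyEval p = f := by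
  simp [polyFun, MvPolynomial.mem_restrictTotalDegree]

theorem mem_homFun {d : ℕ} {f : EuclideanSpace ℝ (Fin n) → ℝ} :
    f ∈ homFun n d ↔ ∃ p : MvPolynomial (Fin n) ℝ, p.IsHomogeneous d ∧ polyEval p = f := by
  simp [homFun]

theorem polyEval_mul (p q : MvPolynomial (Fin n) ℝ) :
    polyEval (p * q) = polyEval p * polyEval q := by
  ext x; simp [polyEval]

theorem polyFun_mono {d e : ℕ} (h : d ≤ e) : polyFun n d ≤ polyFun n e := by
  intro f hf
  obtain ⟨p, hp, rfl⟩ := mem_polyFun.1 hf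
  exact mem_polyFun.2 ⟨p, hp.trans h, rfl⟩

theorem mul_mem_polyFun {d e : ℕ} {f g : EuclideanSpace ℝ (Fin n) → ℝ}
    (hf : f ∈ polyFun n d) (hg : g ∈ polyFun n e) : f * g ∈ polyFun n (d + e) := by
  obtain ⟨p, hp, rfl⟩ := mem_polyFun.1 hf
  obtain ⟨q, hq, rfl⟩ := mem_polyFun.1 hg
  exact mem_polyFun.2 ⟨p * q, (MvPolynomial.totalDegree_mul p q).trans (add_le_add hp hq),
    polyEval_mul p q⟩

theorem mul_mem_homFun {d e : ℕ} {f g : EuclideanSpace ℝ (Fin n) → ℝ}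
    (hf : f ∈ homFun n d) (hg : g ∈ homFun n e) : f * g ∈ homFun n (d + e) := by
  obtain ⟨p, hp, rfl⟩ := mem_homFun.1 hf
  obtain ⟨q, hq, rfl⟩ := mem_homFun.1 hg
  exact mem_homFun.2 ⟨p * q, hp.mul hq, polyEval_mul p q⟩

theorem homFun_le_polyFun (d : ℕ) : homFun n d ≤ polyFun n d := by
  intro f hf
  obtain ⟨p, hp, rfl⟩ := mem_homFun.1 hf
  exact mem_polyFun.2 ⟨p, hp.totalDegree_le, rfl⟩

theorem const_mem_homFun (c : ℝ) : (fun _ => c) ∈ homFun n 0 :=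
  mem_homFun.2 ⟨MvPolynomial.C c, MvPolynomial.isHomogeneous_C _ c, by ext x; simp [polyEval]⟩

theorem inner_mem_homFun (x : EuclideanSpace ℝ (Fin n)) :
    (fun z => inner ℝ x z) ∈ homFun n 1 := by
  refine mem_homFun.2 ⟨∑ i, MvPolynomial.C (x i) * MvPolynomial.X i, ?_, ?_⟩
  · refine MvPolynomial.IsHomogeneous.sum _ _ _ fun i _ => ?_
    simpa using (MvPolynomial.isHomogeneous_C (Fin n) (x i)).mul
      (MvPolynomial.isHomogeneous_X ℝ i)
  · ext z
    simp [polyEval, PiLp.inner_apply, mul_comm]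

theorem inner_pow_mem_homFun (x : EuclideanSpace ℝ (Fin n)) (k : ℕ) :
    (fun z => inner ℝ x z ^ k) ∈ homFun n k := by
  induction k with
  | zero => simpa using const_mem_homFun (n := n) 1
  | succ k ih =>
    simp only [pow_succ]
    exact mul_mem_homFun ih (inner_mem_homFun x)

theorem normSq_mem_polyFun : (fun z : EuclideanSpace ℝ (Fin n) => ‖z‖ ^ 2) ∈ polyFun n 2 := by
  refine homFun_le_polyFun 2 (mem_homFun.2 ⟨∑ i, MvPolynomial.X i ^ 2, ?_, ?_⟩)
  · exact MvPolynomial.IsHomogeneous.sum _ _ _ fun i _ => MvPolynomial.isHomogeneous_X_pow i 2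
  · ext z
    simp [polyEval, EuclideanSpace.norm_sq_eq]

theorem const_mem_polyFun (c : ℝ) (d : ℕ) : (fun _ => c) ∈ polyFun n d :=
  polyFun_mono (Nat.zero_le d) (homFun_le_polyFun 0 (const_mem_homFun c))

theorem eval_inner_mem_polyFun (P : Polynomial ℝ) (x : EuclideanSpace ℝ (Fin n)) :
    (fun z => P.eval (inner ℝ x z)) ∈ polyFun n P.natDegree := by
  have : (fun z => P.eval (inner ℝ x z)) =
      ∑ k ∈ Finset.range (P.natDegree + 1), P.coeff k • fun z => inner ℝ x z ^ k := by
    ext z; simp [Polynomial.eval_eq_sum_range]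
  rw [this]
  refine Submodule.sum_mem _ fun k hk => Submodule.smul_mem _ _ ?_
  exact polyFun_mono (Nat.lt_succ_iff.1 (Finset.mem_range.1 hk))
    (homFun_le_polyFun k (inner_pow_mem_homFun x k))

theorem continuous_of_mem_polyFun {d : ℕ} {f : EuclideanSpace ℝ (Fin n) → ℝ}
    (hf : f ∈ polyFun n d) : Continuous f := by
  obtain ⟨p, -, rfl⟩ := mem_polyFun.1 hf
  exact (MvPolynomial.continuous_eval p).comp (by fun_prop)

theorem totalDegree_aeval_le {σ τ : Type*} (g : σ → MvPolynomial τ ℝ)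
    (hg : ∀ i, (g i).totalDegree ≤ 1) (p : MvPolynomial σ ℝ) :
    (MvPolynomial.aeval g p).totalDegree ≤ p.totalDegree := by
  rw [MvPolynomial.aeval_def, MvPolynomial.eval₂_eq]
  refine MvPolynomial.totalDegree_finsetSum_le fun m hm => ?_
  refine (MvPolynomial.totalDegree_mul _ _).trans ?_
  rw [MvPolynomial.algebraMap_eq, MvPolynomial.totalDegree_C, zero_add]
  refine (MvPolynomial.totalDegree_finsetProd _ _).trans ?_
  refine le_trans (Finset.sum_le_sum fun i _ => ?_) (MvPolynomial.le_totalDegree hm)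
  refine (MvPolynomial.totalDegree_pow _ _).trans ?_
  simpa using Nat.mul_le_mul_left (m i) (hg i)

theorem eval_aeval {σ τ : Type*} (g : σ → MvPolynomial τ ℝ) (x : τ → ℝ) (p : MvPolynomial σ ℝ) :
    MvPolynomial.eval x (MvPolynomial.aeval g p) =
      MvPolynomial.eval (fun i => MvPolynomial.eval x (g i)) p := by
  simp only [← MvPolynomial.coe_aeval_eq_eval]
  exact MvPolynomial.comp_aeval_apply g (MvPolynomial.aeval x) p

/-- The polynomial of the `i`-th coordinate of a linear map. -/
def coordPoly (h : EuclideanSpace ℝ (Fin n) →ₗ[ℝ] EuclideanSpace ℝ (Fin n)) (i : Fin n) :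
    MvPolynomial (Fin n) ℝ :=
  ∑ j, MvPolynomial.C (h (EuclideanSpace.single j 1) i) * MvPolynomial.X j

theorem coordPoly_isHomogeneous
    (h : EuclideanSpace ℝ (Fin n) →ₗ[ℝ] EuclideanSpace ℝ (Fin n)) (i : Fin n) :
    (coordPoly h i).IsHomogeneous 1 := by
  refine MvPolynomial.IsHomogeneous.sum _ _ _ fun j _ => ?_
  simpa using (MvPolynomial.isHomogeneous_C (Fin n) (h (EuclideanSpace.single j 1) i)).mul
    (MvPolynomial.isHomogeneous_X ℝ j)

theorem eval_coordPoly (h : EuclideanSpace ℝ (Fin n) →ₗ[ℝ] EuclideanSpace ℝ (Fin n))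
    (i : Fin n) (x : EuclideanSpace ℝ (Fin n)) : polyEval (coordPoly h i) x = h x i := by
  have hx : x = ∑ j, x j • EuclideanSpace.single j (1 : ℝ) := by
    ext k; simp [Pi.single_apply]
  conv_rhs => rw [hx]
  simp [coordPoly, polyEval, map_sum, mul_comm]

theorem polyEval_aeval_coordPoly
    (h : EuclideanSpace ℝ (Fin n) →ₗ[ℝ] EuclideanSpace ℝ (Fin n)) (p : MvPolynomial (Fin n) ℝ) :
    polyEval (MvPolynomial.aeval (coordPoly h) p) = polyEval p ∘ h := by
  ext x
  simp only [polyEval, Function.comp_apply, eval_aeval]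
  congr 2
  ext i
  exact eval_coordPoly h i x

theorem comp_mem_polyFun {d : ℕ} {f : EuclideanSpace ℝ (Fin n) → ℝ} (hf : f ∈ polyFun n d)
    (h : EuclideanSpace ℝ (Fin n) →ₗ[ℝ] EuclideanSpace ℝ (Fin n)) : f ∘ h ∈ polyFun n d := by
  obtain ⟨p, hp, rfl⟩ := mem_polyFun.1 hf
  exact mem_polyFun.2 ⟨_, (totalDegree_aeval_le _
    (fun i => (coordPoly_isHomogeneous h i).totalDegree_le) p).trans hp,
    polyEval_aeval_coordPoly h p⟩

theorem comp_mem_homFun {d : ℕ} {f : EuclideanSpace ℝ (Fin n) → ℝ} (hf : f ∈ homFun n d)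
    (h : EuclideanSpace ℝ (Fin n) →ₗ[ℝ] EuclideanSpace ℝ (Fin n)) : f ∘ h ∈ homFun n d := by
  obtain ⟨p, hp, rfl⟩ := mem_homFun.1 hf
  exact mem_homFun.2 ⟨_, by simpa using hp.aeval _ (coordPoly_isHomogeneous h),
    polyEval_aeval_coordPoly h p⟩

theorem homFun_le_parityFun {e i : ℕ} (hi : 2 * i ≤ e) : homFun n (e - 2 * i) ≤ parityFun n e :=
  le_iSup₂_of_le (f := fun i (_ : i ∈ Finset.range (e / 2 + 1)) => homFun n (e - 2 * i)) i
    (Finset.mem_range.2 (by omega)) le_rfl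

theorem parityFun_le {e : ℕ} {V : Submodule ℝ (EuclideanSpace ℝ (Fin n) → ℝ)}
    (h : ∀ i, 2 * i ≤ e → homFun n (e - 2 * i) ≤ V) : parityFun n e ≤ V :=
  iSup₂_le fun i hi => h i (by have := Finset.mem_range.1 hi; omega)

theorem parityFun_le_polyFun (e : ℕ) : parityFun n e ≤ polyFun n e :=
  parityFun_le fun _ _ => (homFun_le_polyFun _).trans (polyFun_mono (Nat.sub_le _ _))

theorem comp_mem_parityFun {e : ℕ} {f : EuclideanSpace ℝ (Fin n) → ℝ} (hf : f ∈ parityFun n e)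
    (h : EuclideanSpace ℝ (Fin n) →ₗ[ℝ] EuclideanSpace ℝ (Fin n)) : f ∘ h ∈ parityFun n e := by
  have : parityFun n e ≤ (parityFun n e).comap (LinearMap.funLeft ℝ ℝ h) :=
    parityFun_le fun i hi g hg => homFun_le_parityFun hi (comp_mem_homFun hg h)
  exact this hf

theorem inner_mul_mem_parityFun {e : ℕ} {f : EuclideanSpace ℝ (Fin n) → ℝ}
    (hf : f ∈ parityFun n e) (v : EuclideanSpace ℝ (Fin n)) :
    (fun z => inner ℝ v z * f z) ∈ parityFun n (e + 1) := by
  have : parityFun n e ≤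
      (parityFun n (e + 1)).comap (LinearMap.mulLeft ℝ fun z => inner ℝ v z) := by
    refine parityFun_le fun i hi g hg => ?_
    have h1 := mul_mem_homFun (inner_mem_homFun v) hg
    rw [show 1 + (e - 2 * i) = e + 1 - 2 * i by omega] at h1
    exact homFun_le_parityFun (by omega) h1
  exact this hf

theorem homFun_neg {d : ℕ} {f : EuclideanSpace ℝ (Fin n) → ℝ} (hf : f ∈ homFun n d)
    (x : EuclideanSpace ℝ (Fin n)) : f (-x) = (-1) ^ d * f x := by
  obtain ⟨p, hp, rfl⟩ := mem_homFun.1 hf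
  simp only [polyEval, MvPolynomial.eval_eq', Finset.mul_sum]
  refine Finset.sum_congr rfl fun m hm => ?_
  have hd : ∑ i, m i = d := by
    rw [← hp (MvPolynomial.mem_support_iff.1 hm), ← Finsupp.degree_eq_sum,
      Finsupp.degree_eq_weight_one]
    rfl
  rw [← hd, ← Finset.prod_pow_eq_pow_sum, mul_left_comm, ← Finset.prod_mul_distrib]
  congr 1
  refine Finset.prod_congr rfl fun i _ => ?_
  rw [← mul_pow]
  simp

theorem parityFun_neg {e : ℕ} {f : EuclideanSpace ℝ (Fin n) → ℝ} (hf : f ∈ parityFun n e)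
    (x : EuclideanSpace ℝ (Fin n)) : f (-x) = (-1) ^ e * f x := by
  have : parityFun n e ≤ LinearMap.ker
      ((LinearMap.proj (-x) : (EuclideanSpace ℝ (Fin n) → ℝ) →ₗ[ℝ] ℝ) -
        ((-1 : ℝ) ^ e) • LinearMap.proj x) := by
    refine parityFun_le fun i hi g hg => ?_
    have h1 := homFun_neg hg x
    have h2 : (-1 : ℝ) ^ e = (-1) ^ (e - 2 * i) := by
      conv_lhs => rw [← Nat.sub_add_cancel hi, pow_add, pow_mul]
      simp
    simp [h1, h2]
  have := this hf
  simpa [sub_eq_zero] using this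

/-! ### Averages over spheres and invariance of the design functional -/

/-- The homeomorphism of the unit sphere induced by a linear isometry. -/
def sphereHomeomorph (h : EuclideanSpace ℝ (Fin n) ≃ₗᵢ[ℝ] EuclideanSpace ℝ (Fin n)) :
    sphere (0 : EuclideanSpace ℝ (Fin n)) 1 ≃ₜ sphere (0 : EuclideanSpace ℝ (Fin n)) 1 :=
  h.toHomeomorph.subtype fun x => by simp

theorem measurePreserving_sphereHomeomorph
    (h : EuclideanSpace ℝ (Fin n) ≃ₗᵢ[ℝ] EuclideanSpace ℝ (Fin n)) :
    MeasurePreserving (sphereHomeomorph h).toMeasurableEquiv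
      (volume : Measure (EuclideanSpace ℝ (Fin n))).toSphere
      (volume : Measure (EuclideanSpace ℝ (Fin n))).toSphere := by
  refine ⟨(sphereHomeomorph h).toMeasurableEquiv.measurable, ?_⟩
  ext s hs
  rw [MeasurableEquiv.map_apply, Measure.toSphere_apply' _ hs,
    Measure.toSphere_apply' _ ((sphereHomeomorph h).toMeasurableEquiv.measurable hs)]
  congr 1
  conv_rhs => rw [← h.measurePreserving.measure_preimage_emb h.toHomeomorph.measurableEmbedding]
  congr 1
  ext x
  simp only [Set.mem_smul, Set.mem_image, Set.mem_preimage]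
  constructor
  · rintro ⟨a, ha, _, ⟨u, hu, rfl⟩, rfl⟩
    exact ⟨a, ha, _, ⟨_, hu, rfl⟩, by simp [sphereHomeomorph]⟩
  · rintro ⟨a, ha, _, ⟨u, hu, rfl⟩, hx⟩
    refine ⟨a, ha, _, ⟨(sphereHomeomorph h).symm u, by simpa using hu, rfl⟩, ?_⟩
    apply h.injective
    have : h ((sphereHomeomorph h).symm u : EuclideanSpace ℝ (Fin n)) = u :=
      congrArg Subtype.val ((sphereHomeomorph h).apply_symm_apply u)
    rw [map_smul, this, hx]

theorem sphereAverage_comp (h : EuclideanSpace ℝ (Fin n) ≃ₗᵢ[ℝ] EuclideanSpace ℝ (Fin n))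
    (r : ℝ) (f : EuclideanSpace ℝ (Fin n) → ℝ) :
    sphereAverage r (f ∘ h) = sphereAverage r f := by
  unfold sphereAverage
  rw [average_eq, average_eq]
  congr 1
  rw [← (measurePreserving_sphereHomeomorph h).integral_comp'
    (fun u => f (r • (u : EuclideanSpace ℝ (Fin n))))]
  refine integral_congr_ae (Filter.Eventually.of_forall fun u => ?_)
  simp [sphereHomeomorph]

theorem exists_smul_sphere (hn : 0 < n) {r : ℝ} {x : EuclideanSpace ℝ (Fin n)} (hx : ‖x‖ = r) :
    ∃ u : sphere (0 : EuclideanSpace ℝ (Fin n)) 1, r • (u : EuclideanSpace ℝ (Fin n)) = x := by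
  rcases eq_or_ne x 0 with rfl | h0
  · refine ⟨⟨EuclideanSpace.single ⟨0, hn⟩ 1, by simp⟩, ?_⟩
    rw [← hx]; simp
  · refine ⟨⟨r⁻¹ • x, ?_⟩, ?_⟩
    · rw [← hx]; simp [norm_smul, h0]
    · have : r ≠ 0 := by rw [← hx]; simpa using h0
      simp [smul_smul, this]

theorem sphereAverage_nonneg {r : ℝ} (hr : 0 ≤ r) {f : EuclideanSpace ℝ (Fin n) → ℝ}
    (hf : ∀ x, ‖x‖ = r → 0 ≤ f x) : 0 ≤ sphereAverage r f := by
  unfold sphereAverage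
  rw [average_eq]
  refine smul_nonneg (inv_nonneg.2 measureReal_nonneg) (integral_nonneg fun u => hf _ ?_)
  simp [norm_smul, abs_of_nonneg hr]

theorem eq_zero_of_sphereAverage_eq_zero (hn : 0 < n) {r : ℝ} (hr : 0 ≤ r)
    {f : EuclideanSpace ℝ (Fin n) → ℝ} (hc : Continuous f)
    (hf : ∀ x, ‖x‖ = r → 0 ≤ f x) (h0 : sphereAverage r f = 0) :
    ∀ x, ‖x‖ = r → f x = 0 := by
  have : Nonempty (Fin n) := ⟨⟨0, hn⟩⟩
  have hne : (volume : Measure (EuclideanSpace ℝ (Fin n))).toSphere ≠ 0 :=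
    Measure.toSphere_ne_zero _
  set g : sphere (0 : EuclideanSpace ℝ (Fin n)) 1 → ℝ :=
    fun u => f (r • (u : EuclideanSpace ℝ (Fin n))) with hg
  have hgc : Continuous g := by fun_prop
  have hg0 : 0 ≤ g := fun u => hf _ (by simp [norm_smul, abs_of_nonneg hr])
  have hint : ∫ u, g u ∂(volume : Measure (EuclideanSpace ℝ (Fin n))).toSphere = 0 := by
    unfold sphereAverage at h0
    rw [average_eq, smul_eq_zero] at h0
    refine h0.resolve_left (inv_ne_zero ?_)
    rw [measureReal_ne_zero_iff]
    exact Measure.measure_univ_ne_zero.2 hne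
  have hgi : Integrable g (volume : Measure (EuclideanSpace ℝ (Fin n))).toSphere :=
    hgc.integrable_of_hasCompactSupport (HasCompactSupport.of_compactSpace g)
  rw [integral_eq_zero_iff_of_nonneg hg0 hgi, hgc.ae_eq_iff_eq _ continuous_zero] at hint
  intro x hx
  obtain ⟨u, rfl⟩ := exists_smul_sphere hn hx
  exact congrFun hint u

/-- The two consequences of the design equations on which the argument rests: the discrete
functional `f ↦ ∑ w(u) f(u)` on polynomial functions of degree at most `t` is invariant under
linear isometries, and it is strictly positive on nonnegative functions that do not vanish on the
supporting spheres. -/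
structure IsInvariantCubature (t : ℕ) (X : Finset (EuclideanSpace ℝ (Fin n)))
    (w : EuclideanSpace ℝ (Fin n) → ℝ) : Prop where
  comp_isometry : ∀ f ∈ polyFun n t,
    ∀ h : EuclideanSpace ℝ (Fin n) ≃ₗᵢ[ℝ] EuclideanSpace ℝ (Fin n),
      ∑ u ∈ X, w u * f (h u) = ∑ u ∈ X, w u * f u
  eq_zero : ∀ f ∈ polyFun n t, (∀ x ∈ supportingSpheres X, 0 ≤ f x) → ∑ u ∈ X, w u * f u = 0 →
    ∀ x ∈ supportingSpheres X, f x = 0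

theorem radii_nonneg {X : Finset (EuclideanSpace ℝ (Fin n))} {r : ℝ} (hr : r ∈ radii X) :
    0 ≤ r := by
  obtain ⟨x, -, rfl⟩ := Finset.mem_image.1 hr
  exact norm_nonneg x

theorem norm_mem_radii {X : Finset (EuclideanSpace ℝ (Fin n))} {x : EuclideanSpace ℝ (Fin n)}
    (hx : x ∈ X) : ‖x‖ ∈ radii X :=
  Finset.mem_image_of_mem _ hx

theorem mem_layer {X : Finset (EuclideanSpace ℝ (Fin n))} {r : ℝ}
    {x : EuclideanSpace ℝ (Fin n)} : x ∈ layer X r ↔ x ∈ X ∧ ‖x‖ = r :=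
  Finset.mem_filter

theorem layer_weight_pos {X : Finset (EuclideanSpace ℝ (Fin n))}
    {w : EuclideanSpace ℝ (Fin n) → ℝ} (hw : ∀ x ∈ X, 0 < w x) {r : ℝ} (hr : r ∈ radii X) :
    0 < ∑ x ∈ layer X r, w x := by
  obtain ⟨x, hx, rfl⟩ := Finset.mem_image.1 hr
  exact Finset.sum_pos (fun y hy => hw y (mem_layer.1 hy).1) ⟨x, mem_layer.2 ⟨hx, rfl⟩⟩

theorem IsEuclideanDesign.isInvariantCubature (hn : 0 < n) {t : ℕ}
    {X : Finset (EuclideanSpace ℝ (Fin n))} {w : EuclideanSpace ℝ (Fin n) → ℝ}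
    (hw : ∀ x ∈ X, 0 < w x) (hX : IsEuclideanDesign t X w) : IsInvariantCubature t X w where
  comp_isometry f hf h := by
    obtain ⟨q, hq, hqf⟩ := mem_polyFun.1 (comp_mem_polyFun hf h.toLinearEquiv.toLinearMap)
    obtain ⟨p, hp, rfl⟩ := mem_polyFun.1 hf
    have h1 := hX q hq
    rw [hqf] at h1
    rw [← hX p hp]
    refine h1.symm.trans (Finset.sum_congr rfl fun r _ => ?_)
    congr 1
    exact sphereAverage_comp h r (polyEval p)
  eq_zero f hf hpos h0 := by
    have hc := continuous_of_mem_polyFun hf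
    obtain ⟨p, hp, rfl⟩ := mem_polyFun.1 hf
    rw [← hX p hp, Finset.sum_eq_zero_iff_of_nonneg] at h0
    · intro x hx
      refine eq_zero_of_sphereAverage_eq_zero hn (norm_nonneg x) hc
        (fun y hy => hpos y (by rw [supportingSpheres, Set.mem_ofPred_eq, hy]; exact hx)) ?_ x rfl
      exact (mul_eq_zero.1 (h0 _ hx)).resolve_left (layer_weight_pos hw hx).ne'
    · intro r hr
      refine mul_nonneg (layer_weight_pos hw hr).le (sphereAverage_nonneg (radii_nonneg hr) ?_)
      exact fun y hy => hpos y (by rw [supportingSpheres, Set.mem_ofPred_eq, hy]; exact hr)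

/-- Multiplication by `‖z‖² - s²`, where `s` is the radius of the other layer, passes from the
design to a layer, at the expense of two degrees. -/
theorem IsInvariantCubature.layer_comp_isometry {t : ℕ}
    {X : Finset (EuclideanSpace ℝ (Fin n))} {w : EuclideanSpace ℝ (Fin n) → ℝ}
    (hX : IsInvariantCubature (t + 2) X w) {r s : ℝ} (hrs : r ≠ s) (hrad : radii X = {r, s})
    {f : EuclideanSpace ℝ (Fin n) → ℝ} (hf : f ∈ polyFun n t)
    (h : EuclideanSpace ℝ (Fin n) ≃ₗᵢ[ℝ] EuclideanSpace ℝ (Fin n)) :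
    ∑ u ∈ layer X r, w u * f (h u) = ∑ u ∈ layer X r, w u * f u := by
  have hr : 0 ≤ r := radii_nonneg (X := X) (by simp [hrad])
  have hs : 0 ≤ s := radii_nonneg (X := X) (by simp [hrad])
  have key : ∀ g : EuclideanSpace ℝ (Fin n) → ℝ,
      ∑ u ∈ X, w u * (g u * (‖u‖ ^ 2 - s ^ 2)) =
        (r ^ 2 - s ^ 2) * ∑ u ∈ layer X r, w u * g u := by
    intro g
    rw [layer, Finset.sum_filter, Finset.mul_sum]
    refine Finset.sum_congr rfl fun u hu => ?_
    have hu' := norm_mem_radii hu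
    rw [hrad, Finset.mem_insert, Finset.mem_singleton] at hu'
    split_ifs with h1
    · rw [h1]; ring
    · rw [hu'.resolve_left h1]; ring
  have hmem : (fun u => f u * (‖u‖ ^ 2 - s ^ 2)) ∈ polyFun n (t + 2) :=
    mul_mem_polyFun hf (sub_mem normSq_mem_polyFun (const_mem_polyFun (s ^ 2) 2))
  have h1 := hX.comp_isometry _ hmem h
  simp only [LinearIsometryEquiv.norm_map] at h1
  rw [key f, key fun u => f (h u)] at h1
  refine mul_left_cancel₀ ?_ h1
  rw [sub_ne_zero]
  exact fun h2 => hrs ((sq_eq_sq₀ hr hs).1 h2)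

theorem IsInvariantCubature.layer_eq_zero {t : ℕ}
    {X : Finset (EuclideanSpace ℝ (Fin n))} {w : EuclideanSpace ℝ (Fin n) → ℝ}
    (hX : IsInvariantCubature (t + 2) X w) {r s : ℝ} (hrs : r ≠ s) (hrad : radii X = {r, s})
    {f : EuclideanSpace ℝ (Fin n) → ℝ} (hf : f ∈ polyFun n t)
    (hpos : ∀ x, ‖x‖ = r → 0 ≤ f x) (h0 : ∑ u ∈ layer X r, w u * f u = 0) :
    ∀ x, ‖x‖ = r → f x = 0 := by
  have hr : 0 ≤ r := radii_nonneg (X := X) (by simp [hrad])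
  have hs : 0 ≤ s := radii_nonneg (X := X) (by simp [hrad])
  have hne : r ^ 2 - s ^ 2 ≠ 0 := by
    rw [sub_ne_zero]
    exact fun h2 => hrs ((sq_eq_sq₀ hr hs).1 h2)
  -- The factor `r² - s²` makes the product nonnegative on both spheres.
  have hmem : (fun u => f u * ((r ^ 2 - s ^ 2) * (‖u‖ ^ 2 - s ^ 2))) ∈ polyFun n (t + 2) :=
    mul_mem_polyFun hf (Submodule.smul_mem _ (r ^ 2 - s ^ 2)
      (sub_mem normSq_mem_polyFun (const_mem_polyFun (s ^ 2) 2)))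
  have hsupp : ∀ x ∈ supportingSpheres X, ‖x‖ = r ∨ ‖x‖ = s := fun x hx => by
    simpa [supportingSpheres, hrad] using hx
  have h1 := hX.eq_zero _ hmem ?_ ?_
  · intro x hx
    have h2 := h1 x (by simp [supportingSpheres, hrad, hx])
    rw [hx] at h2
    exact (mul_eq_zero.1 h2).resolve_right (mul_ne_zero hne hne)
  · intro x hx
    rcases hsupp x hx with h | h
    · rw [h]
      exact mul_nonneg (hpos x h) (mul_self_nonneg _)
    · rw [h]; simp
  · rw [← mul_zero ((r ^ 2 - s ^ 2) * (r ^ 2 - s ^ 2)), ← h0, layer, Finset.sum_filter,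
      Finset.mul_sum]
    refine Finset.sum_congr rfl fun u hu => ?_
    have hu' := norm_mem_radii hu
    rw [hrad, Finset.mem_insert, Finset.mem_singleton] at hu'
    split_ifs with h1
    · rw [h1]; ring
    · rw [hu'.resolve_left h1]; ring

/-! ### Reflections and zonal polynomials -/

theorem exists_isometry_apply_eq {x y : EuclideanSpace ℝ (Fin n)} (h : ‖x‖ = ‖y‖) :
    ∃ g : EuclideanSpace ℝ (Fin n) ≃ₗᵢ[ℝ] EuclideanSpace ℝ (Fin n), g x = y :=
  ⟨_, Submodule.reflection_sub h⟩

theorem exists_isometry_fix_apply_eq {x y z : EuclideanSpace ℝ (Fin n)} (h : ‖y‖ = ‖z‖)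
    (hx : inner ℝ x y = inner ℝ x z) :
    ∃ g : EuclideanSpace ℝ (Fin n) ≃ₗᵢ[ℝ] EuclideanSpace ℝ (Fin n), g x = x ∧ g y = z := by
  refine ⟨_, ?_, Submodule.reflection_sub h⟩
  rw [Submodule.reflection_eq_self_iff, Submodule.mem_orthogonal_singleton_iff_inner_left,
    inner_sub_right, hx, sub_self]

/-- Witt's theorem for pairs of vectors. -/
theorem exists_isometry_pair {x y x' y' : EuclideanSpace ℝ (Fin n)} (hx : ‖x‖ = ‖x'‖)
    (hy : ‖y‖ = ‖y'‖) (h : inner ℝ x y = inner ℝ x' y') :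
    ∃ g : EuclideanSpace ℝ (Fin n) ≃ₗᵢ[ℝ] EuclideanSpace ℝ (Fin n), g x = x' ∧ g y = y' := by
  obtain ⟨g, hg⟩ := exists_isometry_apply_eq hx
  obtain ⟨k, hk, hk'⟩ := exists_isometry_fix_apply_eq (x := x') (y := g y) (z := y')
    (by simpa using hy) (by rw [← hg, g.inner_map_map, h, hg])
  exact ⟨g.trans k, by simp [hg, hk], by simp [hk']⟩

theorem exists_unit_orthogonal (hn : 2 ≤ n) (x : EuclideanSpace ℝ (Fin n)) :
    ∃ v : EuclideanSpace ℝ (Fin n), ‖v‖ = 1 ∧ inner ℝ x v = 0 := by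
  have h1 := Submodule.finrank_add_finrank_orthogonal (ℝ ∙ x)
  have h2 : Module.finrank ℝ (ℝ ∙ x) ≤ 1 :=
    (finrank_span_le_card (R := ℝ) ({x} : Set (EuclideanSpace ℝ (Fin n)))).trans (by simp)
  rw [finrank_euclideanSpace_fin] at h1
  have : Nontrivial (ℝ ∙ x)ᗮ := Module.nontrivial_of_finrank_pos (R := ℝ) (by omega)
  obtain ⟨⟨v, hv⟩, hv0⟩ := exists_ne (0 : (ℝ ∙ x)ᗮ)
  have hv0' : v ≠ 0 := fun h => hv0 (Subtype.ext h)
  rw [Submodule.mem_orthogonal_singleton_iff_inner_right] at hv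
  exact ⟨‖v‖⁻¹ • v, by simp [norm_smul, hv0'], by simp [inner_smul_right, hv]⟩

/-- Powers of `B + C c` for different constants `c` differ only in degrees at most
`deg (B ^ j) - 2` if `B` is quadratic. -/
theorem natDegree_pow_add_C_sub_le {B : Polynomial ℝ} (hB : B.natDegree ≤ 2) (c d : ℝ) (j : ℕ) :
    ((B + Polynomial.C c) ^ (j + 1) - (B + Polynomial.C d) ^ (j + 1)).natDegree ≤ 2 * j := by
  have h (c : ℝ) (k : ℕ) : ((B + Polynomial.C c) ^ k).natDegree ≤ 2 * k := by
    refine (Polynomial.natDegree_pow_le_of_le k (m := 2) ?_).trans (by omega)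
    exact (Polynomial.natDegree_add_C).trans_le hB
  rw [← (Commute.all _ _).geom_sum₂_mul]
  have hCd : (B + Polynomial.C c - (B + Polynomial.C d)) = Polynomial.C (c - d) := by
    rw [Polynomial.C_sub]; ring
  rw [hCd]
  refine (Polynomial.natDegree_mul_C_le _ _).trans ?_
  refine Polynomial.natDegree_sum_le_of_forall_le _ _ fun k hk => ?_
  have hk' := Finset.mem_range.1 hk
  exact (Polynomial.natDegree_mul_le_of_le (h c k) (h d (j + 1 - 1 - k))).trans (by omega)

/-- A polynomial function of degree at most `e` which, on each sphere with radius in `R`, depends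
only on the inner product with `x`, is on the sphere of radius `r` a polynomial `Φ r` of degree at
most `e` in this inner product. The two leading coefficients of `Φ r` do not depend on `r`, since
`r` enters only through `r²`, in place of the square of a coordinate orthogonal to `x`. -/
theorem exists_zonal_polynomial (hn : 2 ≤ n) {e : ℕ} {f : EuclideanSpace ℝ (Fin n) → ℝ}
    (hf : f ∈ polyFun n e) {x : EuclideanSpace ℝ (Fin n)} (hx : x ≠ 0) (R : Set ℝ)
    (hinv : ∀ r ∈ R, ∀ z z', ‖z‖ = r → ‖z'‖ = r → inner ℝ x z = inner ℝ x z' → f z = f z') :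
    ∃ Φ : ℝ → Polynomial ℝ, (∀ r, (Φ r).natDegree ≤ e) ∧
      (∀ r s k, e ≤ k + 1 → (Φ r).coeff k = (Φ s).coeff k) ∧
      ∀ r ∈ R, ∀ z, ‖z‖ = r → f z = (Φ r).eval (inner ℝ x z) := by
  obtain ⟨v, hv, hxv⟩ := exists_unit_orthogonal hn x
  have hx0 : ‖x‖ ≠ 0 := norm_ne_zero_iff.2 hx
  obtain ⟨p, hp, rfl⟩ := mem_polyFun.1 hf
  -- The restriction of `p` to the plane spanned by `x` and `v`.
  set q : MvPolynomial (Fin 2) ℝ := MvPolynomial.aeval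
    (fun i => MvPolynomial.C (x i) * MvPolynomial.X 0 + MvPolynomial.C (v i) * MvPolynomial.X 1)
    p with hq
  have hqdeg : q.totalDegree ≤ e := by
    refine (totalDegree_aeval_le _ (fun i => ?_) p).trans hp
    refine (MvPolynomial.totalDegree_add _ _).trans (max_le ?_ ?_) <;>
    · refine (MvPolynomial.totalDegree_mul _ _).trans ?_
      simp
  have hqeval (a b : ℝ) : polyEval p (a • x + b • v) =
      ∑ m ∈ q.support, q.coeff m * (a ^ m 0 * b ^ m 1) := by
    have : polyEval p (a • x + b • v) = MvPolynomial.eval ![a, b] q := by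
      rw [hq, eval_aeval]
      simp [polyEval, mul_comm]
    rw [this, MvPolynomial.eval_eq']
    simp
  set Y : Polynomial ℝ := Polynomial.C (‖x‖ ^ 2)⁻¹ * Polynomial.X with hY
  have hYdeg : Y.natDegree ≤ 1 := (Polynomial.natDegree_C_mul_le _ _).trans Polynomial.natDegree_X_le
  set B : Polynomial ℝ := Polynomial.C (-‖x‖ ^ 2) * Y ^ 2 with hB
  have hBdeg : B.natDegree ≤ 2 :=
    (Polynomial.natDegree_C_mul_le _ _).trans (Polynomial.natDegree_pow_le_of_le 2 hYdeg)
  have hBr (r : ℝ) : (B + Polynomial.C (r ^ 2)).natDegree ≤ 2 :=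
    Polynomial.natDegree_add_C.trans_le hBdeg
  have hm (m) (h : m ∈ q.support) : m 0 + m 1 ≤ e := by
    have h1 := (MvPolynomial.le_totalDegree h).trans hqdeg
    rwa [Finsupp.sum_fintype _ _ (by simp), Fin.sum_univ_two] at h1
  refine ⟨fun r => ∑ m ∈ q.support with Even (m 1), Polynomial.C (q.coeff m) *
    (Y ^ m 0 * (B + Polynomial.C (r ^ 2)) ^ (m 1 / 2)), fun r => ?_, fun r s k hk => ?_,
    fun r hr z hz => ?_⟩
  · refine Polynomial.natDegree_sum_le_of_forall_le _ _ fun m h => ?_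
    have hme := hm m (Finset.mem_filter.1 h).1
    refine (Polynomial.natDegree_C_mul_le _ _).trans ((Polynomial.natDegree_mul_le_of_le
      (Polynomial.natDegree_pow_le_of_le _ hYdeg)
      (Polynomial.natDegree_pow_le_of_le _ (hBr r))).trans ?_)
    omega
  · simp only [Polynomial.finsetSum_coeff]
    refine Finset.sum_congr rfl fun m h => ?_
    have hme := hm m (Finset.mem_filter.1 h).1
    rw [← sub_eq_zero, ← Polynomial.coeff_sub, ← mul_sub, ← mul_sub]
    rcases hj : m 1 / 2 with _ | j
    · simp
    · refine Polynomial.coeff_eq_zero_of_natDegree_lt ?_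
      refine lt_of_le_of_lt ((Polynomial.natDegree_C_mul_le _ _).trans
        (Polynomial.natDegree_mul_le_of_le (Polynomial.natDegree_pow_le_of_le _ hYdeg)
        (natDegree_pow_add_C_sub_le hBdeg _ _ j))) ?_
      omega
  · set a : ℝ := (‖x‖ ^ 2)⁻¹ * inner ℝ x z with ha
    have hax : a * ‖x‖ ^ 2 = inner ℝ x z := by rw [ha]; field_simp
    have hcs : 0 ≤ r ^ 2 - ‖x‖ ^ 2 * a ^ 2 := by
      have h1 : (inner ℝ x z) ^ 2 ≤ (‖x‖ * ‖z‖) ^ 2 :=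
        sq_le_sq' (neg_le_of_abs_le (abs_real_inner_le_norm x z))
          (le_of_abs_le (abs_real_inner_le_norm x z))
      rw [← hax, hz] at h1
      have h2 : 0 < ‖x‖ ^ 2 := by positivity
      have h3 : ‖x‖ ^ 2 * (‖x‖ ^ 2 * a ^ 2) ≤ ‖x‖ ^ 2 * r ^ 2 := by nlinarith
      linarith [le_of_mul_le_mul_left h3 h2]
    obtain ⟨b, hb⟩ : ∃ b : ℝ, b ^ 2 = r ^ 2 - ‖x‖ ^ 2 * a ^ 2 :=
      ⟨√(r ^ 2 - ‖x‖ ^ 2 * a ^ 2), Real.sq_sqrt hcs⟩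
    have hplane (c : ℝ) (hc : c ^ 2 = b ^ 2) : polyEval p z = polyEval p (a • x + c • v) := by
      refine hinv r hr _ _ hz ?_ ?_
      · have h1 : ‖a • x + c • v‖ ^ 2 = r ^ 2 := by
          rw [norm_add_sq_real, inner_smul_left, inner_smul_right, hxv, norm_smul, norm_smul,
            mul_pow, mul_pow, hv]
          simp [hc, hb]
          ring
        have hr0 : 0 ≤ r := hz ▸ norm_nonneg z
        exact (sq_eq_sq₀ (norm_nonneg _) hr0).1 h1
      · rw [inner_add_right, inner_smul_right, inner_smul_right, hxv,
          real_inner_self_eq_norm_sq, hax]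
        simp
    -- Averaging over `b` and `-b` leaves only the even powers of `b`.
    have h1 := hplane b rfl
    have h2 := hplane (-b) (neg_sq b)
    have h3 : polyEval p z = (polyEval p (a • x + b • v) + polyEval p (a • x + (-b) • v)) / 2 := by
      linarith
    rw [h3, hqeval, hqeval, ← Finset.sum_add_distrib, Finset.sum_div, Polynomial.eval_finsetSum,
      Finset.sum_filter]
    refine Finset.sum_congr rfl fun m _ => ?_
    split_ifs with h4
    · have hb2 : b ^ m 1 = (r ^ 2 - ‖x‖ ^ 2 * a ^ 2) ^ (m 1 / 2) := by
        rw [← hb, ← pow_mul, Nat.mul_div_cancel' h4.two_dvd]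
      rw [h4.neg_pow, hb2]
      simp only [Polynomial.eval_mul, Polynomial.eval_C, Polynomial.eval_pow, Polynomial.eval_add,
        hB, hY, Polynomial.eval_X, ← ha]
      ring
    · rw [(Nat.not_even_iff_odd.1 h4).neg_pow]
      ring

/-! ### Dual functions, inner products between layers, and intersection numbers -/

/-- `f` is, up to scaling, the reproducing kernel at `x` of the space `V` for the discrete inner
product, and it vanishes at all points of `X` other than the multiples `σ • x` with `σ ∈ A`. -/
structure IsDualFunction (V : Submodule ℝ (EuclideanSpace ℝ (Fin n) → ℝ)) (A : Finset ℝ) (m : ℝ)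
    (X : Finset (EuclideanSpace ℝ (Fin n))) (w : EuclideanSpace ℝ (Fin n) → ℝ)
    (x : EuclideanSpace ℝ (Fin n)) (f : EuclideanSpace ℝ (Fin n) → ℝ) : Prop where
  mem : f ∈ V
  apply_self : f x = 1
  apply_eq_zero : ∀ z ∈ X, (∀ σ ∈ A, z ≠ σ • x) → f z = 0
  reproducing : ∀ g ∈ V, ∑ u ∈ X, w u * (f u * g u) = m * (w x * g x)

/-- The common output of the tightness assumption for even and odd strength: `V` is a space of
polynomial functions of degree at most `e` that is invariant under linear isometries, and every
nonzero point of `X` has a dual function in `V`. Here `A = {1}`, `m = 1` for even strength,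
and `A = {1, -1}`, `m = 2` for odd strength. -/
structure HasDualFunctions (e : ℕ) (V : Submodule ℝ (EuclideanSpace ℝ (Fin n) → ℝ))
    (A : Finset ℝ) (m : ℝ) (X : Finset (EuclideanSpace ℝ (Fin n)))
    (w : EuclideanSpace ℝ (Fin n) → ℝ) : Prop where
  le : V ≤ polyFun n e
  comp_mem : ∀ f ∈ V, ∀ h : EuclideanSpace ℝ (Fin n) ≃ₗᵢ[ℝ] EuclideanSpace ℝ (Fin n),
    f ∘ h ∈ V
  sq_eq_one : ∀ σ ∈ A, σ ^ 2 = 1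
  smul_mem : ∀ σ ∈ A, ∀ x ∈ X, σ • x ∈ X
  exists_dual : ∀ x ∈ X, x ≠ 0 → ∃ f, IsDualFunction V A m X w x f

section

variable {d t : ℕ} {V : Submodule ℝ (EuclideanSpace ℝ (Fin n) → ℝ)} {A : Finset ℝ} {m : ℝ}
  {X : Finset (EuclideanSpace ℝ (Fin n))} {w : EuclideanSpace ℝ (Fin n) → ℝ}

theorem HasDualFunctions.norm_smul_eq {e : ℕ} (hV : HasDualFunctions e V A m X w) {σ : ℝ}
    (hσ : σ ∈ A) (x : EuclideanSpace ℝ (Fin n)) : ‖σ • x‖ = ‖x‖ := by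
  have h1 : |σ| ^ 2 = 1 := by rw [sq_abs, hV.sq_eq_one σ hσ]
  have h2 : |σ| = 1 := (pow_eq_one_iff_of_nonneg (abs_nonneg σ) two_ne_zero).1 h1
  rw [norm_smul, Real.norm_eq_abs, h2, one_mul]

/-- The discrete inner product determines an element of `V` on the supporting spheres. -/
theorem IsInvariantCubature.eq_of_forall_sum_eq (hX : IsInvariantCubature (t + 2) X w)
    (hdt : 2 * d ≤ t) (hV : HasDualFunctions (d + 1) V A m X w)
    {f f' : EuclideanSpace ℝ (Fin n) → ℝ} (hf : f ∈ V) (hf' : f' ∈ V)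
    (h : ∀ g ∈ V, ∑ u ∈ X, w u * (f u * g u) = ∑ u ∈ X, w u * (f' u * g u))
    {z : EuclideanSpace ℝ (Fin n)} (hz : z ∈ supportingSpheres X) : f z = f' z := by
  have hsub : f - f' ∈ V := sub_mem hf hf'
  have hmem : (f - f') * (f - f') ∈ polyFun n (t + 2) :=
    polyFun_mono (by omega) (mul_mem_polyFun (hV.le hsub) (hV.le hsub))
  have h0 := hX.eq_zero _ hmem (fun x _ => mul_self_nonneg _) ?_ z hz
  · exact sub_eq_zero.1 (mul_self_eq_zero.1 h0)
  · rw [← sub_eq_zero.2 (h _ hsub), ← Finset.sum_sub_distrib]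
    refine Finset.sum_congr rfl fun u _ => ?_
    simp only [Pi.mul_apply, Pi.sub_apply]
    ring

/-- Isometries carry dual functions to dual functions; in particular the weights of points that
correspond under an isometry agree. -/
theorem IsInvariantCubature.dual_comp_isometry (hX : IsInvariantCubature (t + 2) X w)
    (hdt : 2 * d ≤ t) (hw : ∀ x ∈ X, 0 < w x) (hV : HasDualFunctions (d + 1) V A m X w)
    {x x' : EuclideanSpace ℝ (Fin n)} (hx : x ∈ X) (hx' : x' ∈ X)
    {f f' : EuclideanSpace ℝ (Fin n) → ℝ} (hf : IsDualFunction V A m X w x f)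
    (hf' : IsDualFunction V A m X w x' f')
    (h : EuclideanSpace ℝ (Fin n) ≃ₗᵢ[ℝ] EuclideanSpace ℝ (Fin n)) (hxx' : h x = x') :
    w x = w x' ∧ ∀ z ∈ supportingSpheres X, f z = f' (h z) := by
  have h1 : ∀ g ∈ V, ∑ u ∈ X, w u * (f' (h u) * g u) = m * (w x' * g x) := by
    intro g hg
    have hg' := hV.comp_mem g hg h.symm
    have h2 := hX.comp_isometry (f' * (g ∘ h.symm)) (polyFun_mono (by omega)
      (mul_mem_polyFun (hV.le hf'.mem) (hV.le hg'))) h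
    simp only [Pi.mul_apply, Function.comp_apply, h.symm_apply_apply] at h2
    rw [h2]
    have h3 := hf'.reproducing _ hg'
    simp only [Function.comp_apply] at h3
    rw [h3, ← hxx', h.symm_apply_apply]
  have hwx := (hw x hx).ne'
  have hwx' := (hw x' hx').ne'
  have h4 : ∀ z ∈ supportingSpheres X, w x' * f z = w x * f' (h z) := by
    intro z hz
    refine hX.eq_of_forall_sum_eq hdt hV (Submodule.smul_mem V (w x') hf.mem)
      (Submodule.smul_mem V (w x) (hV.comp_mem f' hf'.mem h)) (fun g hg => ?_) hz
    have h5 := congrArg (w x' * ·) (hf.reproducing g hg)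
    have h6 := congrArg (w x * ·) (h1 g hg)
    simp only [Finset.mul_sum] at h5 h6
    have h7 : w x' * (m * (w x * g x)) = w x * (m * (w x' * g x)) := by ring
    rw [h7, ← h6] at h5
    refine Eq.trans (Finset.sum_congr rfl fun u _ => ?_)
      (h5.trans (Finset.sum_congr rfl fun u _ => ?_))
    · simp only [Pi.smul_apply, smul_eq_mul]; ring
    · simp only [Pi.smul_apply, Function.comp_apply, smul_eq_mul]; ring
  have h8 : w x = w x' := by
    have := h4 x (norm_mem_radii hx)
    rw [hxx', hf.apply_self, hf'.apply_self] at this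
    linarith
  refine ⟨h8, fun z hz => ?_⟩
  have := h4 z hz
  rw [h8] at this
  exact mul_left_cancel₀ hwx' this

theorem IsInvariantCubature.weight_eq (hX : IsInvariantCubature (t + 2) X w)
    (hdt : 2 * d ≤ t) (hw : ∀ x ∈ X, 0 < w x) (hV : HasDualFunctions (d + 1) V A m X w)
    {x x' : EuclideanSpace ℝ (Fin n)} (hx : x ∈ X) (hx' : x' ∈ X) (h : ‖x‖ = ‖x'‖) :
    w x = w x' := by
  rcases eq_or_ne x 0 with rfl | h0
  · rw [norm_zero, eq_comm, norm_eq_zero] at h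
    rw [h]
  · have h0' : x' ≠ 0 := by
      rw [← norm_ne_zero_iff, ← h]; exact norm_ne_zero_iff.2 h0
    obtain ⟨f, hf⟩ := hV.exists_dual x hx h0
    obtain ⟨f', hf'⟩ := hV.exists_dual x' hx' h0'
    obtain ⟨g, hg⟩ := exists_isometry_apply_eq h
    exact (hX.dual_comp_isometry hdt hw hV hx hx' hf hf' g hg).1

theorem IsInvariantCubature.exists_zonal_dual (hn : 2 ≤ n)
    (hX : IsInvariantCubature (t + 2) X w)
    (hdt : 2 * d ≤ t) (hw : ∀ x ∈ X, 0 < w x) (hV : HasDualFunctions (d + 1) V A m X w)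
    {x : EuclideanSpace ℝ (Fin n)} (hx : x ∈ X) (hx0 : x ≠ 0)
    {f : EuclideanSpace ℝ (Fin n) → ℝ} (hf : IsDualFunction V A m X w x f) :
    ∃ Φ : ℝ → Polynomial ℝ, (∀ r, (Φ r).natDegree ≤ d + 1) ∧
      (∀ r s k, d ≤ k → (Φ r).coeff k = (Φ s).coeff k) ∧
      ∀ z ∈ supportingSpheres X, f z = (Φ ‖z‖).eval (inner ℝ x z) := by
  obtain ⟨Φ, h1, h2, h3⟩ := exists_zonal_polynomial hn (hV.le hf.mem) hx0 (radii X)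
    (fun r hr z z' hz hz' hzz' => by
      obtain ⟨g, hg, hg'⟩ := exists_isometry_fix_apply_eq (hz.trans hz'.symm) hzz'
      rw [(hX.dual_comp_isometry hdt hw hV hx hx hf hf g hg).2 z (by
        rw [supportingSpheres, Set.mem_ofPred_eq, hz]; exact hr), hg'])
  exact ⟨Φ, h1, fun r s k hk => h2 r s k (by omega), fun z hz => h3 _ hz z rfl⟩

theorem exists_norm_eq_inner_eq (hn : 2 ≤ n) {x : EuclideanSpace ℝ (Fin n)} (hx : x ≠ 0) {c : ℝ}
    (hc : c ∈ Set.Ioo (-‖x‖ ^ 2) (‖x‖ ^ 2)) :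
    ∃ z : EuclideanSpace ℝ (Fin n), ‖z‖ = ‖x‖ ∧ inner ℝ x z = c := by
  obtain ⟨v, hv, hxv⟩ := exists_unit_orthogonal hn x
  have hx0 : 0 < ‖x‖ := norm_pos_iff.2 hx
  have hb : 0 ≤ ‖x‖ ^ 2 - (c / ‖x‖) ^ 2 := by
    rw [div_pow, sub_nonneg, div_le_iff₀ (by positivity)]
    nlinarith [hc.1, hc.2]
  refine ⟨(c / ‖x‖ ^ 2) • x + √(‖x‖ ^ 2 - (c / ‖x‖) ^ 2) • v, ?_, ?_⟩
  · rw [← sq_eq_sq₀ (norm_nonneg _) (norm_nonneg _), norm_add_sq_real, inner_smul_left,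
      inner_smul_right, hxv, norm_smul, norm_smul, mul_pow, mul_pow, hv, Real.norm_eq_abs,
      Real.norm_eq_abs, sq_abs, sq_abs, Real.sq_sqrt hb]
    field_simp
    simp
  · rw [inner_add_right, inner_smul_right, inner_smul_right, hxv, real_inner_self_eq_norm_sq]
    field_simp
    simp

/-- The zonal polynomial of a dual function is nonzero on both spheres. If it vanished on the
sphere of radius `s`, it would lose its two leading coefficients also on the sphere of radius
`r`, and its square times `r⁴ - (x · z)²` would be a nonnegative function of degree at most `2d`
that vanishes on the layer. -/
theorem IsInvariantCubature.zonal_ne_zero (hn : 2 ≤ n)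
    (hX : IsInvariantCubature (t + 2) X w)
    (hdt : 2 * d ≤ t) (hV : HasDualFunctions (d + 1) V A m X w)
    {r s : ℝ} (hrs : r ≠ s) (hrad : radii X = {r, s})
    {x : EuclideanSpace ℝ (Fin n)} (hx : x ∈ layer X r) (hx0 : x ≠ 0)
    {f : EuclideanSpace ℝ (Fin n) → ℝ} (hf : IsDualFunction V A m X w x f)
    {Φ : ℝ → Polynomial ℝ} (hcoeff : ∀ r s k, d ≤ k → (Φ r).coeff k = (Φ s).coeff k)
    (hΦ : ∀ z ∈ supportingSpheres X, f z = (Φ ‖z‖).eval (inner ℝ x z)) :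
    Φ r ≠ 0 ∧ Φ s ≠ 0 := by
  obtain ⟨hxX, rfl⟩ := mem_layer.1 hx
  have hr : Φ ‖x‖ ≠ 0 := by
    intro h
    have := hΦ x (norm_mem_radii hxX)
    rw [h, hf.apply_self] at this
    simp at this
  refine ⟨hr, fun hs => hr ?_⟩
  have hdeg : (Φ ‖x‖).natDegree < d := by
    by_contra! h
    have h1 := hcoeff ‖x‖ s _ h
    rw [hs, Polynomial.coeff_zero, Polynomial.coeff_natDegree,
      Polynomial.leadingCoeff_eq_zero] at h1
    exact hr h1
  set Q : Polynomial ℝ := Φ ‖x‖ ^ 2 * (Polynomial.C (‖x‖ ^ 4) - Polynomial.X ^ 2) with hQ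
  have hQdeg : Q.natDegree ≤ t := by
    refine (Polynomial.natDegree_mul_le_of_le (Polynomial.natDegree_pow_le_of_le 2
      (Nat.le_sub_one_of_lt hdeg)) (n := 2) ?_).trans ?_
    · refine (Polynomial.natDegree_sub_le _ _).trans ?_
      simp
    · omega
  have hQeval (c : ℝ) : Q.eval c = (Φ ‖x‖).eval c ^ 2 * (‖x‖ ^ 4 - c ^ 2) := by
    simp [hQ]
  have hzero := hX.layer_eq_zero hrs hrad (polyFun_mono hQdeg (eval_inner_mem_polyFun Q x)) ?_ ?_
  · refine Polynomial.eq_zero_of_infinite_isRoot _ (Set.Infinite.mono ?_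
      (Set.Ioo_infinite (a := -‖x‖ ^ 2) (b := ‖x‖ ^ 2) ?_))
    · intro c hc
      obtain ⟨z, hz, rfl⟩ := exists_norm_eq_inner_eq hn hx0 hc
      have h1 := hzero z hz
      rw [hQeval] at h1
      refine pow_eq_zero_iff two_ne_zero |>.1 ((mul_eq_zero.1 h1).resolve_right ?_)
      have h2 : 0 < (‖x‖ ^ 2 - inner ℝ x z) * (‖x‖ ^ 2 + inner ℝ x z) :=
        mul_pos (by linarith [hc.2]) (by linarith [hc.1])
      nlinarith
    · have : 0 < ‖x‖ ^ 2 := by positivity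
      linarith
  · intro z hz
    rw [hQeval]
    refine mul_nonneg (sq_nonneg _) ?_
    have h1 := sq_le_sq' (neg_le_of_abs_le (abs_real_inner_le_norm x z))
      (le_of_abs_le (abs_real_inner_le_norm x z))
    rw [hz] at h1
    nlinarith
  · refine Finset.sum_eq_zero fun z hz => ?_
    obtain ⟨hzX, hzr⟩ := mem_layer.1 hz
    rw [hQeval]
    by_cases h : ∀ σ ∈ A, z ≠ σ • x
    · have h1 := hΦ z (norm_mem_radii hzX)
      rw [hf.apply_eq_zero z hzX h, hzr] at h1
      rw [← h1]; simp
    · push Not at h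
      obtain ⟨σ, hσ, rfl⟩ := h
      rw [inner_smul_right, real_inner_self_eq_norm_sq, mul_pow, hV.sq_eq_one σ hσ]
      ring

open Classical in
/-- The inner products between the layers of radius `r` and `s`, except those of `x` with the
points `σ • x`. -/
def innerProducts (X : Finset (EuclideanSpace ℝ (Fin n))) (A : Finset ℝ) (r s : ℝ) : Finset ℝ :=
  ((layer X r ×ˢ layer X s).filter fun p => ∀ σ ∈ A, p.2 ≠ σ • p.1).image
    fun p => inner ℝ p.1 p.2

theorem mem_innerProducts {r s c : ℝ} : c ∈ innerProducts X A r s ↔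
    ∃ x ∈ layer X r, ∃ z ∈ layer X s, (∀ σ ∈ A, z ≠ σ • x) ∧ inner ℝ x z = c := by
  simp only [innerProducts, Finset.mem_image, Finset.mem_filter, Finset.mem_product, Prod.exists]
  grind

theorem IsInvariantCubature.card_innerProducts_le (hn : 2 ≤ n)
    (hX : IsInvariantCubature (t + 2) X w)
    (hdt : 2 * d ≤ t) (hw : ∀ x ∈ X, 0 < w x) (hV : HasDualFunctions (d + 1) V A m X w)
    (hp : (radii X).card = 2) {r s : ℝ} (hr : r ∈ radii X) (hs : s ∈ radii X) (hr0 : r ≠ 0) :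
    (innerProducts X A r s).card ≤ d + 1 := by
  obtain ⟨x, hx, rfl⟩ := Finset.mem_image.1 hr
  have hx0 : x ≠ 0 := norm_ne_zero_iff.1 hr0
  obtain ⟨f, hf⟩ := hV.exists_dual x hx hx0
  obtain ⟨Φ, hdeg, hcoeff, hΦ⟩ := hX.exists_zonal_dual hn hdt hw hV hx hx0 hf
  have hne : Φ s ≠ 0 := by
    obtain ⟨a, b, hab, hrad⟩ := Finset.card_eq_two.1 hp
    have key (r' s' : ℝ) (hrs' : r' ≠ s') (hrad' : radii X = {r', s'}) (h : ‖x‖ = r') :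
        Φ s ≠ 0 := by
      have h1 := hX.zonal_ne_zero hn hdt hV hrs' hrad' (mem_layer.2 ⟨hx, h⟩) hx0 hf hcoeff hΦ
      rw [hrad', Finset.mem_insert, Finset.mem_singleton] at hs
      rcases hs with rfl | rfl
      exacts [h1.1, h1.2]
    have hr' := hr
    rw [hrad, Finset.mem_insert, Finset.mem_singleton] at hr'
    rcases hr' with h | h
    · exact key a b hab hrad h
    · exact key b a hab.symm (by rw [hrad, Finset.pair_comm]) h
  have hsub : innerProducts X A ‖x‖ s ⊆ (Φ s).roots.toFinset := by
    intro c hc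
    obtain ⟨x', hx', z, hz, hσ, rfl⟩ := mem_innerProducts.1 hc
    obtain ⟨hx'X, hx'n⟩ := mem_layer.1 hx'
    obtain ⟨hzX, hzn⟩ := mem_layer.1 hz
    have hx'0 : x' ≠ 0 := by rw [← norm_ne_zero_iff, hx'n]; exact hr0
    obtain ⟨f', hf'⟩ := hV.exists_dual x' hx'X hx'0
    obtain ⟨g, hg⟩ := exists_isometry_apply_eq hx'n
    have h1 := (hX.dual_comp_isometry hdt hw hV hx'X hx hf' hf g hg).2 z (norm_mem_radii hzX)
    rw [hf'.apply_eq_zero z hzX hσ, hΦ (g z) (by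
      rw [supportingSpheres, Set.mem_ofPred_eq, g.norm_map]; exact norm_mem_radii hzX),
      g.norm_map, hzn, ← hg, g.inner_map_map] at h1
    rw [Multiset.mem_toFinset, Polynomial.mem_roots hne]
    exact h1.symm
  calc (innerProducts X A ‖x‖ s).card ≤ (Φ s).roots.toFinset.card := Finset.card_le_card hsub
    _ ≤ (Φ s).roots.card := Multiset.toFinset_card_le _
    _ ≤ (Φ s).natDegree := Polynomial.card_roots' _
    _ ≤ d + 1 := hdeg s

/-- On the product of two layers, the condition `x · z = a` is a polynomial of degree at most `d`
in `x · z`, up to a correction at the points `z = σ • x`. -/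
theorem IsInvariantCubature.exists_indicator_eq (hn : 2 ≤ n)
    (hX : IsInvariantCubature (t + 2) X w)
    (hdt : 2 * d ≤ t) (hw : ∀ x ∈ X, 0 < w x) (hV : HasDualFunctions (d + 1) V A m X w)
    (hp : (radii X).card = 2) {r s : ℝ} (hr : r ∈ radii X) (hs : s ∈ radii X)
    (a : ℝ) : ∃ (P : Polynomial ℝ) (c : ℝ → ℝ), P.natDegree ≤ d ∧
      ∀ x ∈ layer X r, ∀ z ∈ layer X s, (if inner ℝ x z = a then (1 : ℝ) else 0) =
        P.eval (inner ℝ x z) + ∑ σ ∈ A, if z = σ • x then c σ else 0 := by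
  rcases eq_or_ne r 0 with rfl | hr0
  · refine ⟨Polynomial.C (if 0 = a then 1 else 0), 0,
      by simp only [Polynomial.natDegree_C, zero_le], fun x hx z _ => ?_⟩
    have : x = 0 := norm_eq_zero.1 (mem_layer.1 hx).2
    rw [this]
    simp only [inner_zero_left, Polynomial.eval_C, Pi.zero_apply, ite_self,
      Finset.sum_const_zero, add_zero]
  have hcard := hX.card_innerProducts_le hn hdt hw hV hp hr hs hr0
  set P : Polynomial ℝ := Lagrange.interpolate (innerProducts X A r s) id
    (fun c => if c = a then (1 : ℝ) else 0) with hP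
  refine ⟨P, fun σ => (if σ * s ^ 2 = a then 1 else 0) - P.eval (σ * s ^ 2), ?_,
    fun x hx z hz => ?_⟩
  · have h1 := Lagrange.degree_interpolate_lt (s := innerProducts X A r s) (v := id)
      (fun c => if c = a then (1 : ℝ) else 0) Function.injective_id.injOn
    rcases eq_or_ne P 0 with h0 | h0
    · simp [h0]
    · rw [← hP, Polynomial.degree_eq_natDegree h0, Nat.cast_lt] at h1
      omega
  · have hx0 : x ≠ 0 := by rw [← norm_ne_zero_iff, (mem_layer.1 hx).2]; exact hr0
    by_cases h : ∀ σ ∈ A, z ≠ σ • x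
    · rw [Finset.sum_eq_zero fun σ hσ => if_neg (h σ hσ), add_zero]
      exact (Lagrange.eval_interpolate_at_node (v := id)
        (fun c => if c = a then (1 : ℝ) else 0) Function.injective_id.injOn
        (mem_innerProducts.2 ⟨x, hx, z, hz, h, rfl⟩)).symm
    · push Not at h
      obtain ⟨σ, hσ, rfl⟩ := h
      rw [Finset.sum_eq_single_of_mem σ hσ fun τ _ hτ =>
        if_neg fun hτ' => hτ (smul_left_injective ℝ hx0 hτ').symm, if_pos rfl]
      have hn' : ‖x‖ = s := by rw [← hV.norm_smul_eq hσ x, (mem_layer.1 hz).2]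
      rw [inner_smul_right, real_inner_self_eq_norm_sq, hn']
      ring

/-- The mixed moments of degree at most `d` in each variable depend only on the norms and the
inner product of the two points, by invariance and since the weight is constant on layers. -/
theorem IsInvariantCubature.moment_comp_isometry
    (hX : IsInvariantCubature (t + 2) X w)
    (hdt : 2 * d ≤ t) (hw : ∀ x ∈ X, 0 < w x) (hV : HasDualFunctions (d + 1) V A m X w)
    (hp : (radii X).card = 2) {s : ℝ} (hs : s ∈ radii X) {P Q : Polynomial ℝ}
    (hP : P.natDegree ≤ d) (hQ : Q.natDegree ≤ d) (x y : EuclideanSpace ℝ (Fin n))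
    (g : EuclideanSpace ℝ (Fin n) ≃ₗᵢ[ℝ] EuclideanSpace ℝ (Fin n)) :
    ∑ z ∈ layer X s, P.eval (inner ℝ (g x) z) * Q.eval (inner ℝ (g y) z) =
      ∑ z ∈ layer X s, P.eval (inner ℝ x z) * Q.eval (inner ℝ y z) := by
  obtain ⟨s', hs', hrad⟩ : ∃ s', s ≠ s' ∧ radii X = {s, s'} := by
    obtain ⟨a, b, hab, hrad⟩ := Finset.card_eq_two.1 hp
    have h := hs
    rw [hrad, Finset.mem_insert, Finset.mem_singleton] at h
    rcases h with rfl | rfl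
    exacts [⟨b, hab, hrad⟩, ⟨a, hab.symm, by rw [hrad, Finset.pair_comm]⟩]
  have hmem : (fun z => P.eval (inner ℝ (g x) z) * Q.eval (inner ℝ (g y) z)) ∈ polyFun n t :=
    polyFun_mono (by omega)
      (mul_mem_polyFun (eval_inner_mem_polyFun P (g x)) (eval_inner_mem_polyFun Q (g y)))
  have h1 := hX.layer_comp_isometry hs' hrad hmem g
  simp only [g.inner_map_map] at h1
  obtain ⟨u, hu, hus⟩ := Finset.mem_image.1 hs
  have h2 (F : EuclideanSpace ℝ (Fin n) → ℝ) :
      ∑ z ∈ layer X s, w z * F z = w u * ∑ z ∈ layer X s, F z := by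
    rw [Finset.mul_sum]
    refine Finset.sum_congr rfl fun z hz => ?_
    rw [hX.weight_eq hdt hw hV (mem_layer.1 hz).1 hu ((mem_layer.1 hz).2.trans hus.symm)]
  rw [h2, h2] at h1
  exact (mul_left_cancel₀ (hw u hu).ne' h1).symm

theorem sum_layer_correction {e : ℕ} (hV : HasDualFunctions e V A m X w) (s : ℝ) (c : ℝ → ℝ)
    {x : EuclideanSpace ℝ (Fin n)} (hx : x ∈ X) (F : EuclideanSpace ℝ (Fin n) → ℝ) :
    ∑ z ∈ layer X s, (∑ σ ∈ A, if z = σ • x then c σ else 0) * F z =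
      if ‖x‖ = s then ∑ σ ∈ A, c σ * F (σ • x) else 0 := by
  simp only [Finset.sum_mul, ite_mul, zero_mul]
  rw [Finset.sum_comm]
  split_ifs with h
  · refine Finset.sum_congr rfl fun σ hσ => ?_
    rw [Finset.sum_ite_eq', if_pos (mem_layer.2 ⟨hV.smul_mem σ hσ x hx, ?_⟩)]
    rw [hV.norm_smul_eq hσ, h]
  · refine Finset.sum_eq_zero fun σ hσ => ?_
    rw [Finset.sum_ite_eq', if_neg fun h' => h ?_]
    rw [← (mem_layer.1 h').2, hV.norm_smul_eq hσ]

open Classical in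
/-- The number of `z` in a layer with prescribed inner products with `x` and `y` depends only on
the norms and the inner product of `x` and `y`. -/
theorem IsInvariantCubature.card_filter_inner_eq (hn : 2 ≤ n)
    (hX : IsInvariantCubature (t + 2) X w)
    (hdt : 2 * d ≤ t) (hw : ∀ x ∈ X, 0 < w x) (hV : HasDualFunctions (d + 1) V A m X w)
    (hp : (radii X).card = 2) {s : ℝ} (hs : s ∈ radii X) (a b : ℝ)
    {x y x' y' : EuclideanSpace ℝ (Fin n)} (hx : x ∈ X) (hy : y ∈ X) (hx' : x' ∈ X)
    (hy' : y' ∈ X) (hxx' : ‖x‖ = ‖x'‖) (hyy' : ‖y‖ = ‖y'‖)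
    (hinner : inner ℝ x y = inner ℝ x' y') :
    ((layer X s).filter fun z => inner ℝ x z = a ∧ inner ℝ z y = b).card =
      ((layer X s).filter fun z => inner ℝ x' z = a ∧ inner ℝ z y' = b).card := by
  obtain ⟨P, c, hP, hPc⟩ := hX.exists_indicator_eq hn hdt hw hV hp (norm_mem_radii hx) hs a
  obtain ⟨Q, c', hQ, hQc⟩ := hX.exists_indicator_eq hn hdt hw hV hp (norm_mem_radii hy) hs b
  obtain ⟨g, rfl, rfl⟩ := exists_isometry_pair hxx' hyy' hinner
  have key : ∀ u ∈ layer X ‖x‖, ∀ v ∈ layer X ‖y‖,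
      ((((layer X s).filter fun z => inner ℝ u z = a ∧ inner ℝ z v = b).card : ℕ) : ℝ) =
      ∑ z ∈ layer X s, P.eval (inner ℝ u z) * Q.eval (inner ℝ v z) +
      (if ‖u‖ = s then ∑ σ ∈ A, c σ * (Q.eval (inner ℝ v (σ • u)) +
        ∑ τ ∈ A, if σ • u = τ • v then c' τ else 0) else 0) +
      (if ‖v‖ = s then ∑ τ ∈ A, c' τ * P.eval (inner ℝ u (τ • v)) else 0) := by
    intro u hu v hv
    rw [← sum_layer_correction hV s c (mem_layer.1 hu).1 fun z => Q.eval (inner ℝ v z) +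
        ∑ τ ∈ A, if z = τ • v then c' τ else 0,
      ← sum_layer_correction hV s c' (mem_layer.1 hv).1 fun z => P.eval (inner ℝ u z),
      ← Finset.sum_add_distrib, ← Finset.sum_add_distrib, Finset.card_filter, Nat.cast_sum]
    refine Finset.sum_congr rfl fun z hz => ?_
    have h1 := hPc u hu z hz
    have h2 := hQc v hv z hz
    rw [real_inner_comm z v] at h2
    have h3 : (((if inner ℝ u z = a ∧ inner ℝ z v = b then 1 else 0 : ℕ)) : ℝ) =
        (if inner ℝ u z = a then 1 else 0) * (if inner ℝ z v = b then 1 else 0) := by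
      by_cases h4 : inner ℝ u z = a <;> by_cases h5 : inner ℝ z v = b <;> simp [h4, h5]
    rw [h3, h1, h2, real_inner_comm z v]
    ring
  have h1 := key x (mem_layer.2 ⟨hx, rfl⟩) y (mem_layer.2 ⟨hy, rfl⟩)
  have h2 := key (g x) (mem_layer.2 ⟨hx', hxx'.symm⟩) (g y) (mem_layer.2 ⟨hy', hyy'.symm⟩)
  rw [hX.moment_comp_isometry hdt hw hV hp hs hP hQ] at h2
  simp only [← map_smul, g.inner_map_map, g.norm_map, EmbeddingLike.apply_eq_iff_eq] at h2
  exact_mod_cast h1.trans h2.symm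

end

/-! ### The coherent configuration -/

section

variable {X : Finset (EuclideanSpace ℝ (Fin n))}

theorem innerRelation_eq_of_mem {r s a r' s' a' : ℝ} {p : X × X}
    (h : p ∈ innerRelation X r s a) (h' : p ∈ innerRelation X r' s' a') :
    innerRelation X r s a = innerRelation X r' s' a' := by
  obtain ⟨h1, h2, h3⟩ := h
  obtain ⟨h1', h2', h3'⟩ := h'
  obtain rfl : r = r' := h1.symm.trans h1'
  obtain rfl : s = s' := h2.symm.trans h2'
  unfold innerRelation
  rw [← h3, ← h3']

theorem exists_mem_innerRelation (p : X × X) : ∃ r s a, p ∈ innerRelation X r s a := by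
  refine ⟨_, _, inner ℝ (p.1 : EuclideanSpace ℝ (Fin n)) (p.2 : EuclideanSpace ℝ (Fin n)) /
    (‖(p.1 : EuclideanSpace ℝ (Fin n))‖ * ‖(p.2 : EuclideanSpace ℝ (Fin n))‖), rfl, rfl, ?_⟩
  rcases eq_or_ne (‖(p.1 : EuclideanSpace ℝ (Fin n))‖ * ‖(p.2 : EuclideanSpace ℝ (Fin n))‖) 0
    with h | h
  -- If one of the points is `0`, both sides vanish.
  · rw [h, mul_zero]
    rcases mul_eq_zero.1 h with h | h <;> simp [norm_eq_zero.1 h]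
  · exact (div_mul_cancel₀ _ h).symm

theorem isPartition_innerRelations : Setoid.IsPartition (innerRelations X) := by
  refine ⟨fun h => Set.not_nonempty_empty h.1, fun p => ?_⟩
  obtain ⟨r, s, a, hp⟩ := exists_mem_innerRelation p
  refine ⟨innerRelation X r s a, ⟨⟨⟨p, hp⟩, r, s, a, rfl⟩, hp⟩, ?_⟩
  rintro _ ⟨⟨-, r', s', a', rfl⟩, hp'⟩
  exact innerRelation_eq_of_mem hp' hp

theorem eq_of_mem_innerRelation {r s a : ℝ} {x y z : X} (hx : (x, x) ∈ innerRelation X r s a)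
    (hyz : (y, z) ∈ innerRelation X r s a) : y = z := by
  obtain ⟨h1, h2, h3⟩ := hx
  obtain ⟨h4, h5, h6⟩ := hyz
  dsimp only at h1 h2 h3 h4 h5 h6
  obtain rfl : r = s := h1.symm.trans h2
  rw [← h3, real_inner_self_eq_norm_sq] at h6
  refine Subtype.ext (sub_eq_zero.1 (norm_eq_zero.1 (pow_eq_zero_iff two_ne_zero |>.1 ?_)))
  rw [norm_sub_sq_real, h6, h4, h5, h1]
  ring

theorem transpose_innerRelation (r s a : ℝ) :
    {p : X × X | (p.2, p.1) ∈ innerRelation X r s a} = innerRelation X s r a := by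
  ext p
  simp only [innerRelation, Set.mem_ofPred_eq, real_inner_comm, mul_comm s r]
  tauto

open Classical in
theorem ncard_innerRelation (r s a s' q b : ℝ) (x y : X) :
    {z : X | (x, z) ∈ innerRelation X r s a ∧ (z, y) ∈ innerRelation X s' q b}.ncard =
      if ‖(x : EuclideanSpace ℝ (Fin n))‖ = r ∧ ‖(y : EuclideanSpace ℝ (Fin n))‖ = q ∧ s = s'
      then ((layer X s).filter fun z =>
        inner ℝ (x : EuclideanSpace ℝ (Fin n)) z = a * (r * s) ∧
        inner ℝ z (y : EuclideanSpace ℝ (Fin n)) = b * (s * q)).card else 0 := by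
  split_ifs with h
  · obtain ⟨h1, h2, rfl⟩ := h
    rw [← Set.ncard_coe_finset, ← Set.ncard_image_of_injective _ Subtype.val_injective]
    congr 1
    ext z
    simp only [Set.mem_image, innerRelation, Set.mem_ofPred_eq, h1, h2, Finset.coe_filter,
      mem_layer, true_and, Subtype.exists, exists_and_right, exists_eq_right]
    tauto
  · convert Set.ncard_empty X
    refine Set.eq_empty_of_forall_notMem fun z hz => h ?_
    exact ⟨hz.1.1, hz.2.2.1, hz.1.2.1.symm.trans hz.2.1⟩

end

theorem IsInvariantCubature.isCoherentConfiguration {d t : ℕ}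
    {V : Submodule ℝ (EuclideanSpace ℝ (Fin n) → ℝ)} {A : Finset ℝ} {m : ℝ}
    {X : Finset (EuclideanSpace ℝ (Fin n))} {w : EuclideanSpace ℝ (Fin n) → ℝ} (hn : 2 ≤ n)
    (hX : IsInvariantCubature (t + 2) X w) (hdt : 2 * d ≤ t) (hw : ∀ x ∈ X, 0 < w x)
    (hV : HasDualFunctions (d + 1) V A m X w) (hp : (radii X).card = 2) :
    IsCoherentConfiguration (innerRelations X) where
  partition := isPartition_innerRelations
  diagonal := by
    rintro _ ⟨-, r, s, a, rfl⟩ ⟨x, hx⟩ y z hyz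
    exact eq_of_mem_innerRelation hx hyz
  transpose := by
    rintro _ ⟨⟨p, hp'⟩, r, s, a, rfl⟩
    exact ⟨⟨(p.2, p.1), hp'⟩, s, r, a, transpose_innerRelation r s a⟩
  intersection := by
    rintro _ ⟨⟨p, hp'⟩, r, s, a, rfl⟩ _ ⟨-, s', q, b, rfl⟩ _ ⟨⟨⟨x, y⟩, hxy⟩, r'', s'', c, rfl⟩
    refine ⟨{z : X | (x, z) ∈ innerRelation X r s a ∧ (z, y) ∈ innerRelation X s' q b}.ncard,
      fun x' y' hxy' => ?_⟩
    rw [ncard_innerRelation, ncard_innerRelation]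
    have hs : s ∈ radii X := by
      rw [← hp'.2.1]; exact norm_mem_radii p.2.2
    have h1 := hxy'.1.trans hxy.1.symm
    have h2 := hxy'.2.1.trans hxy.2.1.symm
    have h3 := hxy'.2.2.trans hxy.2.2.symm
    rw [hX.card_filter_inner_eq hn hdt hw hV hp hs _ _ x'.2 y'.2 x.2 y.2 h1 h2 h3]
    dsimp only at h1 h2
    rw [h1, h2]

/-! ### Restriction to the points of a design and even strength -/

/-- Restriction of functions on `ℝⁿ` to the points of a finite set. -/
def restrictPoints (X : Finset (EuclideanSpace ℝ (Fin n))) :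
    (EuclideanSpace ℝ (Fin n) → ℝ) →ₗ[ℝ] (X → ℝ) :=
  LinearMap.funLeft ℝ ℝ Subtype.val

@[simp]
theorem restrictPoints_apply (X : Finset (EuclideanSpace ℝ (Fin n)))
    (f : EuclideanSpace ℝ (Fin n) → ℝ) (x : X) : restrictPoints X f x = f x := rfl

theorem restrictTo_eq_comp (S : Set (EuclideanSpace ℝ (Fin n))) :
    restrictTo S = (LinearMap.funLeft ℝ ℝ (Subtype.val : S → EuclideanSpace ℝ (Fin n))).comp
      (polyEvalLinear n) := rfl

theorem polyOn_eq_map (S : Set (EuclideanSpace ℝ (Fin n))) (e : ℕ) :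
    polyOn S e = (polyFun n e).map
      (LinearMap.funLeft ℝ ℝ (Subtype.val : S → EuclideanSpace ℝ (Fin n))) := by
  rw [polyOn, restrictTo_eq_comp, Submodule.map_comp, polyFun]

theorem parityPolyOn_eq_map (S : Set (EuclideanSpace ℝ (Fin n))) (e : ℕ) :
    parityPolyOn S e = (parityFun n e).map
      (LinearMap.funLeft ℝ ℝ (Subtype.val : S → EuclideanSpace ℝ (Fin n))) := by
  rw [parityPolyOn, restrictTo_eq_comp, Submodule.map_comp, parityFun]
  simp only [Submodule.map_iSup, homFun]

section

variable {e t : ℕ} {X : Finset (EuclideanSpace ℝ (Fin n))} {w : EuclideanSpace ℝ (Fin n) → ℝ}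

/-- A polynomial function of degree at most `t / 2` that vanishes at the points of the design
vanishes on the supporting spheres, so its restrictions to both have the same dimension. -/
theorem IsInvariantCubature.finrank_map_eq (hX : IsInvariantCubature t X w) (het : 2 * e ≤ t)
    {V : Submodule ℝ (EuclideanSpace ℝ (Fin n) → ℝ)} (hV : V ≤ polyFun n e) :
    Module.finrank ℝ (V.map (LinearMap.funLeft ℝ ℝ
      (Subtype.val : supportingSpheres X → EuclideanSpace ℝ (Fin n)))) =
      Module.finrank ℝ (V.map (restrictPoints X)) := by
  set W := V.map (LinearMap.funLeft ℝ ℝ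
      (Subtype.val : supportingSpheres X → EuclideanSpace ℝ (Fin n))) with hW
  set ρ : (supportingSpheres X → ℝ) →ₗ[ℝ] (X → ℝ) :=
    LinearMap.funLeft ℝ ℝ fun x => ⟨x, norm_mem_radii x.2⟩ with hρ
  have h1 : V.map (restrictPoints X) = LinearMap.range (ρ.domRestrict W) := by
    rw [LinearMap.range_domRestrict, hW, ← Submodule.map_comp]
    rfl
  rw [h1, LinearMap.finrank_range_of_inj]
  rw [← LinearMap.ker_eq_bot, LinearMap.ker_eq_bot']
  rintro ⟨_, f, hf, rfl⟩ h0
  have h2 (x) (hx : x ∈ X) : f x = 0 := congrFun h0 ⟨x, hx⟩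
  have h3 := hX.eq_zero (f * f) (polyFun_mono (by omega) (mul_mem_polyFun (hV hf) (hV hf)))
    (fun x _ => mul_self_nonneg _)
    (Finset.sum_eq_zero fun u hu => by simp [h2 u hu])
  refine Subtype.ext (funext fun z => ?_)
  exact mul_self_eq_zero.1 (h3 z z.2)

theorem IsInvariantCubature.hasDualFunctions_of_even (hX : IsInvariantCubature t X w)
    (het : 2 * e ≤ t)
    (hcard : X.card = Module.finrank ℝ (polyOn (supportingSpheres X) e)) :
    HasDualFunctions e (polyFun n e) {1} 1 X w where
  le := le_rfl
  comp_mem f hf h := comp_mem_polyFun hf h.toLinearEquiv.toLinearMap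
  sq_eq_one σ hσ := by rw [Finset.mem_singleton.1 hσ, one_pow]
  smul_mem σ hσ x hx := by rwa [Finset.mem_singleton.1 hσ, one_smul]
  exists_dual x hx _ := by
    classical
    rw [polyOn_eq_map, hX.finrank_map_eq het le_rfl] at hcard
    have htop : (polyFun n e).map (restrictPoints X) = ⊤ := by
      refine Submodule.eq_top_of_finrank_eq ?_
      rw [← hcard, Module.finrank_fintype_fun_eq_card, Fintype.card_coe]
    obtain ⟨f, hf, hfx⟩ : Pi.single ⟨x, hx⟩ 1 ∈ (polyFun n e).map (restrictPoints X) := by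
      rw [htop]; trivial
    have hfz (z) (hz : z ∈ X) : f z = if z = x then 1 else 0 := by
      have := congrFun hfx ⟨z, hz⟩
      simpa [Pi.single_apply] using this
    refine ⟨f, hf, by simp [hfz x hx], fun z hz h => ?_, fun g _ => ?_⟩
    · rw [hfz z hz, if_neg]
      simpa using h 1 (Finset.mem_singleton_self 1)
    · rw [Finset.sum_eq_single_of_mem x hx, hfz x hx]
      · simp
      · intro z hz hzx
        simp [hfz z hz, hzx]

end

/-! ### Odd strength: antipodality and dual functions -/

/-- The functions on the finite set `X` that vanish at the origin, if the origin belongs to `X`. -/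
def vanishingAtZero (X : Finset (EuclideanSpace ℝ (Fin n))) : Submodule ℝ (X → ℝ) where
  carrier := {u | ∀ x : X, (x : EuclideanSpace ℝ (Fin n)) = 0 → u x = 0}
  add_mem' ha hb x hx := by simp [ha x hx, hb x hx]
  zero_mem' _ _ := rfl
  smul_mem' c a ha x hx := by simp [ha x hx]

/-- Multiplication by the linear form of `v` on functions on `X`. -/
def mulInner (X : Finset (EuclideanSpace ℝ (Fin n))) (v : EuclideanSpace ℝ (Fin n)) :
    (X → ℝ) →ₗ[ℝ] (X → ℝ) :=
  LinearMap.mulLeft ℝ fun x : X => inner ℝ v (x : EuclideanSpace ℝ (Fin n))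

@[simp]
theorem mulInner_apply (X : Finset (EuclideanSpace ℝ (Fin n))) (v : EuclideanSpace ℝ (Fin n))
    (u : X → ℝ) (x : X) : mulInner X v u x = inner ℝ v (x : EuclideanSpace ℝ (Fin n)) * u x := rfl

theorem exists_forall_inner_ne_zero (X : Finset (EuclideanSpace ℝ (Fin n))) :
    ∃ v : EuclideanSpace ℝ (Fin n), ∀ x ∈ X, x ≠ 0 → inner ℝ v x ≠ 0 := by
  obtain ⟨v, hv⟩ := Module.Dual.exists_forall_ne_zero_of_forall_exists
    (ι := {x : X // (x : EuclideanSpace ℝ (Fin n)) ≠ 0})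
    (fun x => innerₗ (EuclideanSpace ℝ (Fin n)) x.1.1)
    (fun x => ⟨x.1.1, by simpa using x.2⟩)
  exact ⟨v, fun x hx h0 => by
    rw [real_inner_comm]
    exact hv ⟨⟨x, hx⟩, h0⟩⟩

/-- Multiplication by a linear form without zeros in `X \ {0}` is injective on functions that
vanish at the origin. -/
theorem mulInner_domRestrict_injective {X : Finset (EuclideanSpace ℝ (Fin n))}
    {U : Submodule ℝ (X → ℝ)} (hU : U ≤ vanishingAtZero X) {v₀ : EuclideanSpace ℝ (Fin n)}
    (hv₀ : ∀ x ∈ X, x ≠ 0 → inner ℝ v₀ x ≠ 0) :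
    Function.Injective ((mulInner X v₀).domRestrict U) := by
  rw [← LinearMap.ker_eq_bot, LinearMap.ker_eq_bot']
  rintro ⟨a, ha⟩ h0
  refine Subtype.ext (funext fun x => ?_)
  by_cases hx : (x : EuclideanSpace ℝ (Fin n)) = 0
  · exact hU ha x hx
  · exact (mul_eq_zero.1 (congrFun h0 x)).resolve_left (hv₀ x x.2 hx)

theorem ne_neg_of_ne_zero {x : EuclideanSpace ℝ (Fin n)} (hx : x ≠ 0) : x ≠ -x := by
  intro h
  have h1 : (2 : ℝ) • x = 0 := by
    rw [two_smul]; nth_rw 2 [h]; exact add_neg_cancel x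
  exact hx ((smul_eq_zero.1 h1).resolve_left two_ne_zero)

theorem finrank_vanishingAtZero (X : Finset (EuclideanSpace ℝ (Fin n))) :
    X.card ≤ Module.finrank ℝ (vanishingAtZero X) + 1 := by
  by_cases h : (0 : EuclideanSpace ℝ (Fin n)) ∈ X
  · have h1 : vanishingAtZero X = LinearMap.ker
        (LinearMap.proj (⟨0, h⟩ : X) : (X → ℝ) →ₗ[ℝ] ℝ) := by
      ext u
      refine ⟨fun hu => hu ⟨0, h⟩ rfl, fun hu x hx => ?_⟩
      obtain rfl : x = ⟨0, h⟩ := Subtype.ext hx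
      exact hu
    have h2 := LinearMap.finrank_range_add_finrank_ker
      (LinearMap.proj (⟨0, h⟩ : X) : (X → ℝ) →ₗ[ℝ] ℝ)
    have h3 := Submodule.finrank_le (LinearMap.range
      (LinearMap.proj (⟨0, h⟩ : X) : (X → ℝ) →ₗ[ℝ] ℝ))
    rw [Module.finrank_fintype_fun_eq_card, Fintype.card_coe] at h2
    rw [Module.finrank_self] at h3
    rw [h1]
    omega
  · have h1 : vanishingAtZero X = ⊤ := by
      rw [eq_top_iff]
      exact fun u _ x hx => absurd (hx ▸ x.2) h
    rw [h1, finrank_top, Module.finrank_fintype_fun_eq_card, Fintype.card_coe]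
    omega

section

variable {d e t : ℕ} {X : Finset (EuclideanSpace ℝ (Fin n))} {w : EuclideanSpace ℝ (Fin n) → ℝ}

theorem IsInvariantCubature.sum_eq_zero_of_parity (hX : IsInvariantCubature (2 * e + 1) X w)
    {f g : EuclideanSpace ℝ (Fin n) → ℝ} (hf : f ∈ parityFun n e) (hg : g ∈ parityFun n (e + 1)) :
    ∑ u ∈ X, w u * (f u * g u) = 0 := by
  have h1 := hX.comp_isometry (f * g) (polyFun_mono (by omega)
    (mul_mem_polyFun (parityFun_le_polyFun e hf) (parityFun_le_polyFun (e + 1) hg)))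
    (LinearIsometryEquiv.neg ℝ)
  have h2 : ∀ u, w u * (f * g) (LinearIsometryEquiv.neg ℝ u) = -(w u * (f u * g u)) := by
    intro u
    have h3 : (-1 : ℝ) ^ e * (-1) ^ (e + 1) = -1 := by
      rw [← pow_add, Odd.neg_one_pow ⟨e, by ring⟩]
    simp only [LinearIsometryEquiv.coe_neg, Pi.mul_apply, parityFun_neg hf, parityFun_neg hg]
    linear_combination w u * f u * g u * h3
  rw [Finset.sum_congr rfl fun u _ => h2 u, Finset.sum_neg_distrib] at h1
  simp only [Pi.mul_apply] at h1
  linarith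

theorem IsInvariantCubature.disjoint_parity (hX : IsInvariantCubature (2 * e + 1) X w)
    (hw : ∀ x ∈ X, 0 < w x) :
    Disjoint ((parityFun n e).map (restrictPoints X))
      ((parityFun n (e + 1)).map (restrictPoints X)) := by
  rw [Submodule.disjoint_def]
  rintro _ ⟨f, hf, rfl⟩ ⟨g, hg, hfg⟩
  have h1 := hX.sum_eq_zero_of_parity hf hg
  have h2 (x) (hx : x ∈ X) : g x = f x := congrFun hfg ⟨x, hx⟩
  rw [Finset.sum_eq_zero_iff_of_nonneg fun x hx => by
    rw [h2 x hx]; exact mul_nonneg (hw x hx).le (mul_self_nonneg _)] at h1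
  ext x
  have h3 := h1 x x.2
  rw [h2 x x.2] at h3
  exact mul_self_eq_zero.1 ((mul_eq_zero.1 h3).resolve_left (hw x x.2).ne')

open Classical in
/-- The dimension count in the case of equality in Möller's bound for odd strength. -/
theorem IsInvariantCubature.finrank_parity_bounds (hX : IsInvariantCubature (2 * e + 1) X w)
    (hw : ∀ x ∈ X, 0 < w x)
    (hcard : X.card = if Even e ∧ (0 : EuclideanSpace ℝ (Fin n)) ∈ X then
      2 * Module.finrank ℝ ((parityFun n e).map (restrictPoints X)) - 1
      else 2 * Module.finrank ℝ ((parityFun n e).map (restrictPoints X))) :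
    Module.finrank ℝ ((parityFun n (e + 1)).map (restrictPoints X)) ≤
      Module.finrank ℝ
        ((parityFun n e).map (restrictPoints X) ⊓ vanishingAtZero X : Submodule ℝ (X → ℝ)) ∧
    X.card ≤ Module.finrank ℝ ((parityFun n e).map (restrictPoints X)) + Module.finrank ℝ
        ((parityFun n e).map (restrictPoints X) ⊓ vanishingAtZero X : Submodule ℝ (X → ℝ)) := by
  have h1 := Submodule.finrank_add_finrank_le_of_disjoint (hX.disjoint_parity hw)
  rw [Module.finrank_fintype_fun_eq_card, Fintype.card_coe] at h1
  split_ifs at hcard with h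
  · have h2 := Submodule.finrank_sup_add_finrank_inf_eq
      ((parityFun n e).map (restrictPoints X)) (vanishingAtZero X)
    have h3 := Submodule.finrank_le
      ((parityFun n e).map (restrictPoints X) ⊔ vanishingAtZero X)
    rw [Module.finrank_fintype_fun_eq_card, Fintype.card_coe] at h3
    have h4 := finrank_vanishingAtZero X
    omega
  · have h2 : (parityFun n e).map (restrictPoints X) ≤ vanishingAtZero X := by
      rintro _ ⟨f, hf, rfl⟩ x hx
      have hodd : Odd e := Nat.not_even_iff_odd.1 fun he => h ⟨he, hx ▸ x.2⟩
      have h3 := parityFun_neg hf 0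
      rw [hodd.neg_one_pow, neg_zero] at h3
      rw [restrictPoints_apply, hx]
      linarith
    rw [inf_eq_left.2 h2]
    omega

/-- If multiplication by linear forms maps `U` to a space `W` of no larger dimension, then `U`
is invariant under multiplication by quotients of linear forms. -/
theorem inner_div_inner_mul_mem {U W : Submodule ℝ (X → ℝ)} (hU : U ≤ vanishingAtZero X)
    (hUW : ∀ v, ∀ u ∈ U, mulInner X v u ∈ W)
    (hdim : Module.finrank ℝ W ≤ Module.finrank ℝ U) {v₀ : EuclideanSpace ℝ (Fin n)}
    (hv₀ : ∀ x ∈ X, x ≠ 0 → inner ℝ v₀ x ≠ 0) (v : EuclideanSpace ℝ (Fin n)) {u : X → ℝ}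
    (hu : u ∈ U) :
    (fun x : X => inner ℝ v (x : EuclideanSpace ℝ (Fin n)) /
      inner ℝ v₀ (x : EuclideanSpace ℝ (Fin n)) * u x) ∈ U := by
  have hinj := mulInner_domRestrict_injective hU hv₀
  have hmap : U.map (mulInner X v₀) = W := by
    refine Submodule.eq_of_le_of_finrank_le ?_ ?_
    · rintro _ ⟨a, ha, rfl⟩
      exact hUW v₀ a ha
    · rw [← LinearMap.range_domRestrict, LinearMap.finrank_range_of_inj hinj]
      exact hdim
  obtain ⟨a, ha, hau⟩ : mulInner X v u ∈ U.map (mulInner X v₀) := by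
    rw [hmap]; exact hUW v u hu
  have hdiv : (fun x : X => inner ℝ v (x : EuclideanSpace ℝ (Fin n)) /
      inner ℝ v₀ (x : EuclideanSpace ℝ (Fin n)) * u x) = a := by
    funext x
    by_cases hx : (x : EuclideanSpace ℝ (Fin n)) = 0
    · rw [hU hu x hx, hU ha x hx, mul_zero]
    · have h1 := congrFun hau x
      simp only [mulInner_apply] at h1
      rw [div_mul_eq_mul_div, ← h1, mul_div_cancel_left₀ _ (hv₀ x x.2 hx)]
  rw [hdiv]
  exact ha

theorem prod_inner_div_inner_mul_mem {U W : Submodule ℝ (X → ℝ)} (hU : U ≤ vanishingAtZero X)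
    (hUW : ∀ v, ∀ u ∈ U, mulInner X v u ∈ W)
    (hdim : Module.finrank ℝ W ≤ Module.finrank ℝ U) {v₀ : EuclideanSpace ℝ (Fin n)}
    (hv₀ : ∀ x ∈ X, x ≠ 0 → inner ℝ v₀ x ≠ 0) {ι : Type*} (T : Finset ι)
    (v : ι → EuclideanSpace ℝ (Fin n)) {u : X → ℝ} (hu : u ∈ U) :
    (fun x : X => (∏ i ∈ T, inner ℝ (v i) (x : EuclideanSpace ℝ (Fin n)) /
      inner ℝ v₀ (x : EuclideanSpace ℝ (Fin n))) * u x) ∈ U := by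
  classical
  induction T using Finset.induction_on with
  | empty => simpa using hu
  | insert i T hi ih =>
    have := inner_div_inner_mul_mem hU hUW hdim hv₀ (v i) ih
    simpa only [Finset.prod_insert hi, mul_assoc] using this

/-- Points at which equality holds in the Cauchy-Schwarz inequality are proportional. -/
theorem exists_eq_smul_of_inner_sq_eq {x z : EuclideanSpace ℝ (Fin n)} (hx : x ≠ 0)
    (h : inner ℝ x z ^ 2 = ‖x‖ ^ 2 * ‖z‖ ^ 2) : ∃ c : ℝ, z = c • x := by
  refine ⟨inner ℝ x z / ‖x‖ ^ 2, ?_⟩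
  have hx0 : ‖x‖ ≠ 0 := norm_ne_zero_iff.2 hx
  refine sub_eq_zero.1 (norm_eq_zero.1 (pow_eq_zero_iff two_ne_zero |>.1 ?_))
  rw [norm_sub_sq_real, inner_smul_right, norm_smul, mul_pow, Real.norm_eq_abs, sq_abs,
    real_inner_comm]
  field_simp
  rw [real_inner_comm] at h
  linarith

open Classical in
/-- A tight design of odd strength is antipodal, with a symmetric weight. The restrictions to `X`
of the two parity spaces are orthogonal, and by the dimension count the functions in the first that
vanish at the origin are invariant under multiplication by quotients of linear forms. A product of such quotients is constant on the line
through `x` and vanishes on the other points of `X`, so the orthogonality relation localizes to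
this line. -/
theorem IsInvariantCubature.neg_mem_and_weight_neg
    (hX : IsInvariantCubature (2 * (d + 1) + 1) X w) (hw : ∀ x ∈ X, 0 < w x)
    (hp : (radii X).card = 2)
    (hdim : Module.finrank ℝ ((parityFun n (d + 1 + 1)).map (restrictPoints X)) ≤
      Module.finrank ℝ
        ((parityFun n (d + 1)).map (restrictPoints X) ⊓ vanishingAtZero X :
          Submodule ℝ (X → ℝ)))
    {x : EuclideanSpace ℝ (Fin n)} (hx : x ∈ X) (hx0 : x ≠ 0) : -x ∈ X ∧ w (-x) = w x := by
  set U : Submodule ℝ (X → ℝ) :=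
    (parityFun n (d + 1)).map (restrictPoints X) ⊓ vanishingAtZero X with hU
  obtain ⟨s, hs, hrad⟩ : ∃ s, ‖x‖ ≠ s ∧ radii X = {‖x‖, s} := by
    obtain ⟨a, b, hab, hrad⟩ := Finset.card_eq_two.1 hp
    have h := norm_mem_radii hx
    rw [hrad, Finset.mem_insert, Finset.mem_singleton] at h
    rcases h with h | h
    · exact ⟨b, h ▸ hab, by rw [h, hrad]⟩
    · exact ⟨a, h ▸ hab.symm, by rw [h, hrad, Finset.pair_comm]⟩
  have hs0 : 0 ≤ s := radii_nonneg (X := X) (by simp [hrad])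
  have hUW : ∀ v, ∀ u ∈ U, mulInner X v u ∈ (parityFun n (d + 1 + 1)).map (restrictPoints X) := by
    rintro v _ ⟨⟨f, hf, rfl⟩, -⟩
    exact ⟨_, inner_mul_mem_parityFun hf v, rfl⟩
  obtain ⟨v₀, hv₀⟩ := exists_forall_inner_ne_zero X
  set T : Finset (EuclideanSpace ℝ (Fin n)) :=
    X.filter fun y => inner ℝ x y ^ 2 ≠ ‖x‖ ^ 2 * ‖y‖ ^ 2 with hT
  -- A vector orthogonal to `y`, but not to `x`.
  set v : EuclideanSpace ℝ (Fin n) → EuclideanSpace ℝ (Fin n) :=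
    fun y => ‖y‖ ^ 2 • x - inner ℝ x y • y with hv
  set k : EuclideanSpace ℝ (Fin n) → ℝ := fun z => ∏ y ∈ T, inner ℝ (v y) z / inner ℝ v₀ z with hk
  have hkx : k x ≠ 0 := by
    refine Finset.prod_ne_zero_iff.2 fun y hy => div_ne_zero ?_ (hv₀ x hx hx0)
    have := (Finset.mem_filter.1 hy).2
    rw [hv, inner_sub_left, inner_smul_left, inner_smul_left, real_inner_self_eq_norm_sq,
      real_inner_comm x y]
    simp only [conj_trivial]
    intro h
    exact this (by linarith)
  have hkT (z) (hz : z ∈ T) : k z = 0 := by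
    refine Finset.prod_eq_zero hz ?_
    rw [hv, inner_sub_left, inner_smul_left, inner_smul_left, real_inner_self_eq_norm_sq]
    simp only [conj_trivial]
    rw [mul_comm, sub_self, zero_div]
  have hkneg : k (-x) = k x := by
    refine Finset.prod_congr rfl fun y _ => ?_
    rw [inner_neg_right, inner_neg_right, neg_div_neg_eq]
  have hf₀ : restrictPoints X (fun z => inner ℝ x z ^ (d + 1)) ∈ U := by
    refine ⟨⟨_, homFun_le_parityFun (i := 0) (by omega) (inner_pow_mem_homFun x _), rfl⟩, ?_⟩
    intro z hz
    simp [hz]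
  obtain ⟨⟨f, hf, hfk⟩, -⟩ := prod_inner_div_inner_mul_mem inf_le_right hUW hdim hv₀ T v hf₀
  have hfX (z) (hz : z ∈ X) : f z = k z * inner ℝ x z ^ (d + 1) := congrFun hfk ⟨z, hz⟩
  -- The second factor makes the summands on the other sphere vanish.
  set g : EuclideanSpace ℝ (Fin n) → ℝ :=
    fun z => inner ℝ x z ^ (d + 2) - (‖x‖ ^ 2 * s ^ 2) * inner ℝ x z ^ d with hg
  have hgmem : g ∈ parityFun n (d + 1 + 1) :=
    sub_mem (homFun_le_parityFun (i := 0) (by omega) (inner_pow_mem_homFun x (d + 2)))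
      (Submodule.smul_mem _ (‖x‖ ^ 2 * s ^ 2)
        (homFun_le_parityFun (i := 1) (by omega) (inner_pow_mem_homFun x d)))
  have hsum := hX.sum_eq_zero_of_parity hf hgmem
  set C : ℝ := k x * (‖x‖ ^ 2) ^ (2 * d + 1) * (‖x‖ ^ 4 - ‖x‖ ^ 2 * s ^ 2) with hC
  have hC0 : C ≠ 0 := by
    have hx0' : ‖x‖ ≠ 0 := norm_ne_zero_iff.2 hx0
    refine mul_ne_zero (mul_ne_zero hkx (by positivity)) ?_
    have h1 : ‖x‖ ^ 2 - s ^ 2 ≠ 0 := by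
      rw [sub_ne_zero]
      exact fun h2 => hs ((sq_eq_sq₀ (norm_nonneg x) hs0).1 h2)
    have h2 : ‖x‖ ^ 4 - ‖x‖ ^ 2 * s ^ 2 = ‖x‖ ^ 2 * (‖x‖ ^ 2 - s ^ 2) := by ring
    rw [h2]
    exact mul_ne_zero (by positivity) h1
  have hxneg : x ≠ -x := ne_neg_of_ne_zero hx0
  have hterm (z) (hz : z ∈ X) : w z * (f z * g z) =
      (if z = x then w x * C else 0) + (if z = -x then -(w (-x) * C) else 0) := by
    rw [hfX z hz]
    by_cases hzx : z = x
    · rw [if_pos hzx, if_neg (fun h => hxneg (hzx.symm.trans h)), hzx, hC, hg]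
      simp only [real_inner_self_eq_norm_sq]
      ring
    by_cases hzn : z = -x
    · rw [if_neg hzx, if_pos hzn, hzn, hC, hg, hkneg]
      simp only [inner_neg_right, real_inner_self_eq_norm_sq]
      have h1 : (-1 : ℝ) ^ (d + 1) * (-1) ^ d = -1 := by
        rw [← pow_add, Odd.neg_one_pow ⟨d, by ring⟩]
      rw [neg_pow (‖x‖ ^ 2) (d + 1), neg_pow (‖x‖ ^ 2) (d + 2), neg_pow (‖x‖ ^ 2) d,
        pow_add (-1 : ℝ) d 2]
      linear_combination w (-x) * k x * (‖x‖ ^ 2) ^ (d + 1) *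
        ((‖x‖ ^ 2) ^ (d + 2) - ‖x‖ ^ 2 * s ^ 2 * (‖x‖ ^ 2) ^ d) * h1
    rw [if_neg hzx, if_neg hzn, add_zero]
    by_cases hzT : z ∈ T
    · rw [hkT z hzT]; ring
    have hline : inner ℝ x z ^ 2 = ‖x‖ ^ 2 * ‖z‖ ^ 2 := by
      by_contra h
      exact hzT (Finset.mem_filter.2 ⟨hz, h⟩)
    have hzs : ‖z‖ = s := by
      have h1 := norm_mem_radii hz
      rw [hrad, Finset.mem_insert, Finset.mem_singleton] at h1
      refine h1.resolve_left fun h2 => ?_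
      obtain ⟨c, rfl⟩ := exists_eq_smul_of_inner_sq_eq hx0 hline
      rw [norm_smul, mul_eq_right₀ (norm_ne_zero_iff.2 hx0), Real.norm_eq_abs,
        abs_eq zero_le_one] at h2
      rcases h2 with rfl | rfl
      · exact hzx (one_smul ℝ x)
      · exact hzn (neg_one_smul ℝ x)
    have hgz : g z = 0 := by
      rw [hg]
      simp only
      rw [pow_add, hline, hzs]
      ring
    rw [hgz]; ring
  rw [Finset.sum_congr rfl hterm, Finset.sum_add_distrib, Finset.sum_ite_eq', if_pos hx,
    Finset.sum_ite_eq'] at hsum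
  have hwx := hw x hx
  split_ifs at hsum with h
  · refine ⟨h, ?_⟩
    have h1 : (w x - w (-x)) * C = 0 := by linarith
    have h2 := (mul_eq_zero.1 h1).resolve_right hC0
    linarith
  · rw [add_zero] at hsum
    exact absurd hsum (mul_ne_zero hwx.ne' hC0)

open Classical in
theorem IsInvariantCubature.hasDualFunctions_of_odd
    (hX : IsInvariantCubature (2 * (d + 1) + 1) X w) (hw : ∀ x ∈ X, 0 < w x)
    (hp : (radii X).card = 2)
    (hcard : X.card = if Even (d + 1) ∧ (0 : EuclideanSpace ℝ (Fin n)) ∈ X then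
      2 * Module.finrank ℝ (parityPolyOn (supportingSpheres X) (d + 1)) - 1
      else 2 * Module.finrank ℝ (parityPolyOn (supportingSpheres X) (d + 1))) :
    HasDualFunctions (d + 1) (parityFun n (d + 1)) {1, -1} 2 X w := by
  rw [parityPolyOn_eq_map, hX.finrank_map_eq (by omega) (parityFun_le_polyFun (d + 1))] at hcard
  obtain ⟨hdim, hdim'⟩ := hX.finrank_parity_bounds hw hcard
  have hanti (x) (hx : x ∈ X) (hx0 : x ≠ 0) : -x ∈ X ∧ w (-x) = w x :=
    hX.neg_mem_and_weight_neg hw hp hdim hx hx0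
  have hneg (x) (hx : x ∈ X) : -x ∈ X := by
    rcases eq_or_ne x 0 with rfl | h0
    · rwa [neg_zero]
    · exact (hanti x hx h0).1
  have hdisj := hX.disjoint_parity hw
  have htop : (parityFun n (d + 1)).map (restrictPoints X) ⊔
      (parityFun n (d + 1 + 1)).map (restrictPoints X) = ⊤ := by
    refine Submodule.eq_top_of_finrank_eq (le_antisymm (Submodule.finrank_le _) ?_)
    have h1 := Submodule.finrank_sup_add_finrank_inf_eq
      ((parityFun n (d + 1)).map (restrictPoints X))
      ((parityFun n (d + 1 + 1)).map (restrictPoints X))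
    rw [hdisj.eq_bot, finrank_bot, add_zero] at h1
    rw [h1, Module.finrank_fintype_fun_eq_card, Fintype.card_coe]
    refine hdim'.trans (Nat.add_le_add_left ?_ _)
    obtain ⟨v₀, hv₀⟩ := exists_forall_inner_ne_zero X
    have hinj := mulInner_domRestrict_injective (U := (parityFun n (d + 1)).map
      (restrictPoints X) ⊓ vanishingAtZero X) inf_le_right hv₀
    rw [← LinearMap.finrank_range_of_inj hinj, LinearMap.range_domRestrict]
    refine Submodule.finrank_mono ?_
    rintro _ ⟨_, ⟨⟨f, hf, rfl⟩, -⟩, rfl⟩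
    exact ⟨_, inner_mul_mem_parityFun hf v₀, rfl⟩
  refine ⟨parityFun_le_polyFun _, fun f hf h => comp_mem_parityFun hf h.toLinearEquiv.toLinearMap,
    fun σ hσ => ?_, fun σ hσ x hx => ?_, fun x hx hx0 => ?_⟩
  · rcases Finset.mem_insert.1 hσ with rfl | hσ
    · simp
    · simp [Finset.mem_singleton.1 hσ]
  · rcases Finset.mem_insert.1 hσ with rfl | hσ
    · rwa [one_smul]
    · rw [Finset.mem_singleton.1 hσ, neg_one_smul]
      exact hneg x hx
  obtain ⟨_, ⟨f, hf, rfl⟩, _, ⟨g, hg, rfl⟩, hfg⟩ :=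
    Submodule.mem_sup.1 (htop ▸ Submodule.mem_top : Pi.single (⟨x, hx⟩ : X) (1 : ℝ) ∈ _)
  have hfgX (z) (hz : z ∈ X) : f z + g z = if z = x then 1 else 0 := by
    have := congrFun hfg ⟨z, hz⟩
    simpa [Pi.single_apply] using this
  -- The part of parity `d + 1` of the indicator function of `x`.
  have hfX (z) (hz : z ∈ X) : 2 * f z =
      (if z = x then 1 else 0) + (-1) ^ (d + 1) * (if z = -x then 1 else 0) := by
    have h1 := hfgX z hz
    have h2 := hfgX (-z) (hneg z hz)
    rw [parityFun_neg hf, parityFun_neg hg] at h2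
    simp only [neg_eq_iff_eq_neg] at h2
    have h3 : (-1 : ℝ) ^ (d + 1) * (-1) ^ (d + 1) = 1 := by
      rw [← mul_pow]; simp
    have h4 : (-1 : ℝ) ^ (d + 1 + 1) = -(-1) ^ (d + 1) := by rw [pow_succ]; ring
    rw [h4] at h2
    rw [← h1, ← h2]
    linear_combination (g z - f z) * h3
  have hxneg : x ≠ -x := ne_neg_of_ne_zero hx0
  refine ⟨(2 : ℝ) • f, Submodule.smul_mem _ _ hf, ?_, fun z hz h => ?_, fun p hp => ?_⟩
  · rw [Pi.smul_apply, smul_eq_mul, hfX x hx, if_pos rfl, if_neg hxneg]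
    ring
  · have h1 := h 1 (by simp)
    have h2 := h (-1) (by simp)
    rw [one_smul] at h1
    rw [neg_one_smul] at h2
    rw [Pi.smul_apply, smul_eq_mul, hfX z hz, if_neg h1, if_neg h2]
    ring
  · have h1 : ∀ z ∈ X, w z * (((2 : ℝ) • f) z * p z) = (if z = x then w x * p x else 0) +
        (if z = -x then w (-x) * ((-1) ^ (d + 1) * p (-x)) else 0) := by
      intro z hz
      rw [Pi.smul_apply, smul_eq_mul, hfX z hz]
      by_cases hzx : z = x
      · rw [hzx, if_pos rfl, if_neg hxneg, if_pos rfl, if_neg hxneg]; ring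
      by_cases hzn : z = -x
      · rw [hzn, if_neg hxneg.symm, if_pos rfl, if_neg hxneg.symm, if_pos rfl]; ring
      · simp [hzx, hzn]
    have h3 : (-1 : ℝ) ^ (d + 1) * (-1) ^ (d + 1) = 1 := by
      rw [← mul_pow]; simp
    rw [Finset.sum_congr rfl h1, Finset.sum_add_distrib, Finset.sum_ite_eq', if_pos hx,
      Finset.sum_ite_eq', if_pos (hneg x hx), parityFun_neg hp, (hanti x hx hx0).2]
    linear_combination w x * p x * h3

end

end EuclideanDesign

end

theorem theorem1p3 (n t : ℕ) (hn : 2 ≤ n) (ht : 2 ≤ t)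
    (X : Finset (EuclideanSpace ℝ (Fin n))) (w : EuclideanSpace ℝ (Fin n) → ℝ)
    (hw : ∀ x ∈ X, 0 < w x)
    (hp : (EuclideanDesign.radii X).card = 2)
    (hX : EuclideanDesign.IsTightEuclideanDesign t X w) :
    EuclideanDesign.IsCoherentConfiguration (EuclideanDesign.innerRelations X) := by
  obtain ⟨hdesign, hcard⟩ := hX
  have hcub := hdesign.isInvariantCubature (by omega) hw
  unfold EuclideanDesign.moellerBound at hcard
  rcases Nat.even_or_odd' t with ⟨e, rfl | rfl⟩
  · obtain ⟨d, rfl⟩ : ∃ d, e = d + 1 := ⟨e - 1, by omega⟩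
    rw [if_pos (even_two_mul _), Nat.mul_div_cancel_left _ two_pos] at hcard
    exact EuclideanDesign.IsInvariantCubature.isCoherentConfiguration (t := 2 * d) hn hcub le_rfl
      hw (hcub.hasDualFunctions_of_even le_rfl hcard) hp
  · obtain ⟨d, rfl⟩ : ∃ d, e = d + 1 := ⟨e - 1, by omega⟩
    have h1 : (2 * (d + 1) + 1) / 2 = d + 1 := by omega
    rw [if_neg (Nat.not_even_two_mul_add_one _), h1] at hcard
    exact EuclideanDesign.IsInvariantCubature.isCoherentConfiguration (t := 2 * d + 1) hn hcub
      (by omega) hw (hcub.hasDualFunctions_of_odd hw hp hcard) hp
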